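/- Let $\mathcal U\subset\mathbb R^{M}$ be an $r$-dimensional subspace, $r\ge 2$, with orthonormal basis matrix $\mathbf U$, let $\mathbf q\in\mathbb R^{M}$ be a unit vector with $\mathbf q\notin\mathcal U$, and put $\mathbf q^{\perp}=\frac{(\mathbf I-\mathbf U\mathbf U^T)\mathbf q}{\|(\mathbf I-\mathbf U\mathbf U^T)\mathbf q\|_2}$. Let $0<\eta<|\mathbf q^T\mathbf q^{\perp}|$, $0<\delta<1$ and $n_o\ge 1$. Let the inliers $\mathbf a_1,\dots,\mathbf a_{n_i}$ be independent and uniformly distributed on $\mathcal U\cap\mathbb S^{M-1}$, and let the outliers be $\mathbf b_i=\frac{1}{\sqrt{1+\eta^2}}(\mathbf q+\eta\mathbf v_i)$, $i=1,\dots,n_o$, with $\mathbf v_1,\dots,\mathbf v_{n_o}$ independent and uniformly distributed on $\mathbb S^{M-1}$. Let $\mathbf D=[\mathbf b_1\cdots\mathbf b_{n_o}\;\mathbf a_1\cdots\mathbf a_{n_i}]$ and let $\mathcal Q$ be the column space of $[\mathbf U\;\mathbf q]$. For a column $\mathbf d_k$ of $\mathbf D$ let $\mathbf c_k^*$ denote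 an optimal point of $$\min_{\mathbf c}\ \|\mathbf c^T\mathbf D\|_1\quad\text{subject to}\quad \mathbf c^T\mathbf d_k=1,\ \mathbf c\in\mathcal Q,$$ and call $1/\|\mathbf D^T\mathbf c_k^*\|_1$ the Innovation Value of $\mathbf d_k$. Define $\beta=\max_{1\le i\le n_o}\frac{1}{|\mathbf b_i^T\mathbf q^\perp|}$, $$\mathcal A=\frac{\sqrt{1+\eta^2}}{2\beta}\left(\sqrt{\tfrac{2}{\pi}}\,\frac{n_i}{\sqrt r}-2\sqrt{n_i}-\sqrt{\frac{2n_i\log\frac1\delta}{r-1}}\right),$$ $$\sqrt{c_\delta}=3\max\left(1,\sqrt{\tfrac{8M\pi}{(M-1)r}},\sqrt{\tfrac{8M\log (n_o/\delta)}{(M-1)r}}\right),\qquad \sqrt{c''_\delta}=3\max\left(1,\sqrt{\tfrac{8M\pi}{M-1}},\sqrt{\tfrac{8M\log (n_o/\delta)}{M-1}}\right).$$ With probability at least $1-5\delta$ the following implication holds. If $$\mathcal A>n_o\|\mathbf U^T\mathbf q\|_2+\eta\sqrt{\frac{n_o\,r\,c_\delta\log (n_o/\delta)}{M}}\quad\text{and}\quad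 \mathcal A>n_o|\mathbf q^T\mathbf q^{\perp}|+n_o\,\eta\sqrt{\frac{c''_\delta\log (n_o/\delta)}{M}},$$ then all the above optimization problems have optimal points; for each outlier $\mathbf d$ the optimal point is unique and equals $\mathbf q^{\perp}/(\mathbf d^T\mathbf q^{\perp})$; and, for every choice of the optimal points, every outlier has a strictly larger Innovation Value than every inlier, and $\mathcal U$ is recovered exactly: when the columns of $\mathbf D$ are sorted by increasing Innovation Value (ties broken arbitrarily), some initial segment of them spans an $r$-dimensional subspace, and every initial segment that spans an $r$-dimensional subspace spans $\mathcal U$. -/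

import Mathlib

open MeasureTheory ProbabilityTheory
open scoped RealInnerProductSpace

namespace ISearch

noncomputable section

/-- The uniform probability distribution on the unit sphere of a finite-dimensional real inner
product space `V`, viewed as a measure on `V`: the normalised surface measure. -/
def sphereUniform (V : Type*) [NormedAddCommGroup V] [InnerProductSpace ℝ V]
    [FiniteDimensional ℝ V] [MeasurableSpace V] [BorelSpace V] : Measure V :=
  (((volume : Measure V).toSphere Set.univ)⁻¹ • (volume : Measure V).toSphere).map Subtype.val

/-- The uniform probability distribution on `U ∩ 𝕊^{M-1}`, as a measure on `ℝ^M`. -/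
def subspaceSphereUniform {M : ℕ} (U : Submodule ℝ (EuclideanSpace ℝ (Fin M))) :
    Measure (EuclideanSpace ℝ (Fin M)) :=
  (sphereUniform U).map Subtype.val

section Algorithm

variable {M : ℕ} {ι : Type*} [Fintype ι]

/-- The objective `‖cᵀ D‖₁`, where the columns of `D` are the points `D k`. -/
def cost (D : ι → EuclideanSpace ℝ (Fin M)) (c : EuclideanSpace ℝ (Fin M)) : ℝ :=
  ∑ k, |⟪c, D k⟫|

/-- The feasible set `cᵀ d = 1`, `c ∈ Q`. -/
def feasible (Q : Submodule ℝ (EuclideanSpace ℝ (Fin M))) (d : EuclideanSpace ℝ (Fin M)) :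
    Set (EuclideanSpace ℝ (Fin M)) :=
  {c | ⟪c, d⟫ = 1 ∧ c ∈ Q}

/-- `c` is an optimal point of: minimise `‖cᵀ D‖₁` subject to `cᵀ d = 1` and `c ∈ Q`. -/
def IsOptimalDirection (D : ι → EuclideanSpace ℝ (Fin M))
    (Q : Submodule ℝ (EuclideanSpace ℝ (Fin M))) (d c : EuclideanSpace ℝ (Fin M)) : Prop :=
  c ∈ feasible Q d ∧ IsMinOn (cost D) (feasible Q d) c

/-- The Innovation Value `1 / ‖Dᵀ c‖₁` of a data point whose optimal direction is `c`. -/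
def innovationValue (D : ι → EuclideanSpace ℝ (Fin M)) (c : EuclideanSpace ℝ (Fin M)) : ℝ :=
  1 / cost D c

/-- The span of the first `k` data points in the ordering `σ` of the columns. -/
def spanOfFirst (D : ι → EuclideanSpace ℝ (Fin M)) (σ : Fin (Fintype.card ι) ≃ ι) (k : ℕ) :
    Submodule ℝ (EuclideanSpace ℝ (Fin M)) :=
  Submodule.span ℝ {y | ∃ j : Fin (Fintype.card ι), (j : ℕ) < k ∧ y = D (σ j)}

/-- The basis-building step, fed with the values `x`, recovers `U` exactly: however the columns
are sorted by increasing value (ties broken arbitrarily), collecting columns from the smallest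
value on does reach an `r`-dimensional span, and every `r`-dimensional span so reached is `U`. -/
def RecoversExactly (D : ι → EuclideanSpace ℝ (Fin M)) (x : ι → ℝ) (r : ℕ)
    (U : Submodule ℝ (EuclideanSpace ℝ (Fin M))) : Prop :=
  ∀ σ : Fin (Fintype.card ι) ≃ ι, Monotone (fun j => x (σ j)) →
    (∃ k : ℕ, Module.finrank ℝ (spanOfFirst D σ k) = r) ∧
    ∀ k : ℕ, Module.finrank ℝ (spanOfFirst D σ k) = r → spanOfFirst D σ k = U

end Algorithm

/-- The clustered outlier `b = (q + η v) / √(1 + η²)`. -/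
def clusteredOutlier {M : ℕ} (q : EuclideanSpace ℝ (Fin M)) (η : ℝ)
    (v : EuclideanSpace ℝ (Fin M)) : EuclideanSpace ℝ (Fin M) :=
  (1 / √(1 + η ^ 2)) • (q + η • v)

/-- The data matrix `D = [B A]`: outliers first, then inliers. -/
def dataMatrix {M ni no : ℕ} (b : Fin no → EuclideanSpace ℝ (Fin M))
    (a : Fin ni → EuclideanSpace ℝ (Fin M)) : Fin no ⊕ Fin ni → EuclideanSpace ℝ (Fin M) :=
  Sum.elim b a

/-- `q^⊥ = (I - U Uᵀ) q / ‖(I - U Uᵀ) q‖₂`. -/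
def qPerp {M : ℕ} (U : Submodule ℝ (EuclideanSpace ℝ (Fin M))) (q : EuclideanSpace ℝ (Fin M)) :
    EuclideanSpace ℝ (Fin M) :=
  (1 / ‖q - U.starProjection q‖) • (q - U.starProjection q)

/-- `β = max_i 1 / |b_iᵀ q^⊥|`, the maximum over the outliers. -/
def beta {M no : ℕ} (U : Submodule ℝ (EuclideanSpace ℝ (Fin M))) (q : EuclideanSpace ℝ (Fin M))
    (b : Fin no → EuclideanSpace ℝ (Fin M)) : ℝ :=
  ⨆ i, 1 / |⟪b i, qPerp U q⟫|

/-- `𝒜 = √(1+η²)/(2β) · (√(2/π) n_i/√r - 2√n_i - √(2 n_i log(1/δ)/(r-1)))`. -/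
def calA (ni r : ℕ) (η β δ : ℝ) : ℝ :=
  √(1 + η ^ 2) / (2 * β) *
    (√(2 / Real.pi) * (ni / √r) - 2 * √ni - √(2 * ni * Real.log (1 / δ) / ((r : ℝ) - 1)))

/-- `√c_δ = 3 max(1, √(8Mπ/((M-1)r)), √(8M log(n_o/δ)/((M-1)r)))`. -/
def cDelta (M r no : ℕ) (δ : ℝ) : ℝ :=
  (3 * max 1 (max √(8 * M * Real.pi / (((M : ℝ) - 1) * r))
    √(8 * M * Real.log (no / δ) / (((M : ℝ) - 1) * r)))) ^ 2

/-- `√c''_δ = 3 max(1, √(8Mπ/(M-1)), √(8M log(n_o/δ)/(M-1)))`. -/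
def cDelta'' (M no : ℕ) (δ : ℝ) : ℝ :=
  (3 * max 1 (max √(8 * M * Real.pi / ((M : ℝ) - 1))
    √(8 * M * Real.log (no / δ) / ((M : ℝ) - 1)))) ^ 2

/-- The two sufficient conditions on `𝒜`, for given outliers `b` (through `β`). -/
def SufficientConditions {M no : ℕ} (ni r : ℕ) (U : Submodule ℝ (EuclideanSpace ℝ (Fin M)))
    (q : EuclideanSpace ℝ (Fin M)) (η δ : ℝ) (b : Fin no → EuclideanSpace ℝ (Fin M)) : Prop :=
  calA ni r η (beta U q b) δ >
      no * ‖U.starProjection q‖ + η * √(no * r * cDelta M r no δ * Real.log (no / δ) / M) ∧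
  calA ni r η (beta U q b) δ >
      no * |⟪q, qPerp U q⟫| + no * η * √(cDelta'' M no δ * Real.log (no / δ) / M)

end

end ISearch

/-! Deterministic core (`recovery_of_permeance`). Write p for the unit vector q^⊥ and P for the
projection onto U. Every c in Q is u + t p with u ∈ U, and the inliers see only u. Suppose the
inliers have permeance L: Σ_j |⟪u, a_j⟫| ≥ L‖u‖ on U. Since η < |qᵀp|, all ⟪p, b_i⟫ have the same
sign. For the outlier b_k the constraint eliminates t, and dropping absolute values in the outlier
part shows that the cost exceeds its value at u = 0 by at least ‖u‖ (L - ‖P Σ b_i‖ - ‖P b_k‖ β Σ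
|⟪p, b_i⟫|). This factor is positive once 2β‖P Σ b_i‖ and 2β Σ |⟪p, b_i⟫| are both below L. So p /
⟪b_k, p⟫ is the unique minimiser, with cost at most β Σ |⟪p, b_i⟫| < L, whereas a direction feasible
for an inlier has ‖u‖ ≥ 1 and hence cost at least L.

Probability. Three events are needed, each failing with probability at most δ: the permeance bound,
a bound on ‖P Σ v_i‖, and a one-sided bound on the component of Σ v_i along ±p. The last two are
Chernoff bounds. By Jensen over the radius of a Gaussian vector g in dimension d, a uniform
direction is sub-Gaussian with variance proxy 1/(E‖g‖)² ≤ 1/(d - 1).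

The permeance bound rests on a Gordon inequality for Laplace transforms
(`lintegral_iSup_exp_neg_abs_le`): for unit vectors x_u, l > 0 and arbitrary offsets w_u, E max_u
exp(w_u - l|⟪x_u, g⟫|) ≤ exp(-l√(2/π)) E max_u exp(w_u + l⟪x_u, h⟫). It comes from interpolation
between two Gaussian families (`integral_rpow_expSum_mono`). Arbitrary offsets let it be applied to
one vector at a time, so it tensorizes (`lintegral_pi_iSup_exp_le`). For n vectors the right side is
controlled by E exp(l‖Σ h_j‖), which does not involve the number of directions, and a dense sequence
of directions suffices. -/

namespace ISearch

/-! ### The standard Gaussian density and integration by parts -/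

section Gaussian

variable {V : Type*} [NormedAddCommGroup V] [InnerProductSpace ℝ V]

/-- The density of the standard Gaussian distribution. -/
noncomputable def gaussDensity (x : V) : ℝ :=
  (2 * Real.pi) ^ (-(Module.finrank ℝ V : ℝ) / 2) * Real.exp (-‖x‖ ^ 2 / 2)

lemma gaussDensity_pos (x : V) : 0 < gaussDensity x := by
  unfold gaussDensity; positivity

lemma continuous_gaussDensity : Continuous (gaussDensity : V → ℝ) := by
  unfold gaussDensity; fun_prop

variable [FiniteDimensional ℝ V] [MeasurableSpace V] [BorelSpace V]

lemma integrable_gaussDensity : Integrable (gaussDensity : V → ℝ) := by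
  refine Integrable.const_mul ?_ _
  have h := GaussianFourier.integrable_cexp_neg_mul_sq_norm_add (V := V) (b := 1 / 2)
    (by norm_num) 0 0
  refine h.norm.congr (ae_of_all _ fun x => ?_)
  simp only [Complex.norm_exp]
  congr 1
  have : (-(1 / 2 : ℂ) * (‖x‖ : ℂ) ^ 2 + 0 * ((⟪(0 : V), x⟫ : ℝ) : ℂ)) =
    ((-‖x‖ ^ 2 / 2 : ℝ) : ℂ) := by
    push_cast; ring
  rw [this, Complex.ofReal_re]

/-- Both sides have characteristic function exp(-‖t‖²/2); for the density this is the Fourier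
transform of a Gaussian. -/
lemma stdGaussian_eq_withDensity :
    stdGaussian V = (volume : Measure V).withDensity fun x => ENNReal.ofReal (gaussDensity x) := by
  have := isFiniteMeasure_withDensity_ofReal (integrable_gaussDensity (V := V)).2
  apply Measure.ext_of_charFun
  ext t
  rw [charFun_stdGaussian, charFun_apply, integral_withDensity_eq_integral_toReal_smul
    (by exact continuous_gaussDensity.measurable.ennreal_ofReal) (by simp)]
  have h := GaussianFourier.integral_cexp_neg_mul_sq_norm_add (V := V) (b := 1 / 2)
    (by norm_num) Complex.I t
  have h2 : ∀ x : V, (ENNReal.ofReal (gaussDensity x)).toReal •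
      Complex.exp ((⟪x, t⟫ : ℝ) * Complex.I) =
      (((2 * Real.pi) ^ (-(Module.finrank ℝ V : ℝ) / 2) : ℝ) : ℂ) *
      Complex.exp (-(1 / 2) * (‖x‖ : ℂ) ^ 2 + Complex.I * (⟪t, x⟫ : ℝ)) := by
    intro x
    rw [ENNReal.toReal_ofReal (gaussDensity_pos x).le, Complex.real_smul, gaussDensity,
      Complex.ofReal_mul, mul_assoc, Complex.ofReal_exp, ← Complex.exp_add, real_inner_comm]
    congr 2
    push_cast
    ring
  simp_rw [h2]
  rw [integral_const_mul, h, ← mul_assoc]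
  have h3 : (((2 * Real.pi) ^ (-(Module.finrank ℝ V : ℝ) / 2) : ℝ) : ℂ) *
      ((Real.pi : ℂ) / (1 / 2)) ^ ((Module.finrank ℝ V : ℂ) / 2) = 1 := by
    have : ((Real.pi : ℂ) / (1 / 2)) ^ ((Module.finrank ℝ V : ℂ) / 2) =
      (((2 * Real.pi) ^ ((Module.finrank ℝ V : ℝ) / 2) : ℝ) : ℂ) := by
      rw [Complex.ofReal_cpow (by positivity)]
      congr 1 <;> push_cast <;> ring
    rw [this, ← Complex.ofReal_mul, ← Real.rpow_add (by positivity)]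
    simp [neg_div]
  rw [h3, one_mul]
  congr 1
  rw [Complex.I_sq]
  ring

lemma integral_stdGaussian {F : Type*} [NormedAddCommGroup F] [NormedSpace ℝ F] (f : V → F) :
    ∫ x, f x ∂stdGaussian V = ∫ x, gaussDensity x • f x := by
  rw [stdGaussian_eq_withDensity, integral_withDensity_eq_integral_toReal_smul
    (by exact continuous_gaussDensity.measurable.ennreal_ofReal) (by simp)]
  simp_rw [ENNReal.toReal_ofReal (gaussDensity_pos _).le]

lemma integrable_stdGaussian_iff {f : V → ℝ} :
    Integrable f (stdGaussian V) ↔ Integrable fun x => gaussDensity x * f x := by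
  rw [stdGaussian_eq_withDensity, integrable_withDensity_iff_integrable_smul'
    (by exact continuous_gaussDensity.measurable.ennreal_ofReal) (by simp)]
  simp_rw [ENNReal.toReal_ofReal (gaussDensity_pos _).le, smul_eq_mul]

/-- Fernique's theorem provides some integrable exp(c‖x‖²), and C‖x‖ ≤ C²/(4c) + c‖x‖². -/
lemma integrable_exp_norm_stdGaussian (C : ℝ) :
    Integrable (fun x : V => Real.exp (C * ‖x‖)) (stdGaussian V) := by
  obtain ⟨c, hc, h⟩ := IsGaussian.exists_integrable_exp_sq (stdGaussian V)
  refine (h.const_mul (Real.exp (C ^ 2 / (4 * c)))).mono' (by fun_prop) (ae_of_all _ fun x => ?_)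
  rw [Real.norm_of_nonneg (Real.exp_pos _).le, ← Real.exp_add, Real.exp_le_exp]
  have : C ^ 2 / (4 * c) + c * ‖x‖ ^ 2 - C * ‖x‖ = (2 * c * ‖x‖ - C) ^ 2 / (4 * c) := by
    field_simp; ring
  have : 0 ≤ (2 * c * ‖x‖ - C) ^ 2 / (4 * c) := by positivity
  linarith

/-- A function of at most exponential growth is integrable. -/
lemma integrable_stdGaussian_of_le_exp {f : V → ℝ} (hf : AEStronglyMeasurable f (stdGaussian V))
    (K C : ℝ) (h : ∀ x, |f x| ≤ K * Real.exp (C * ‖x‖)) : Integrable f (stdGaussian V) :=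
  ((integrable_exp_norm_stdGaussian C).const_mul K).mono' hf (ae_of_all _ h)

/-- Gaussian integration by parts in the direction `v`. -/
lemma integral_inner_mul_stdGaussian {f f' : V → ℝ} (v : V) (hf : Continuous f)
    (hf' : Continuous f') (K C : ℝ) (hK : ∀ x, |f x| ≤ K * Real.exp (C * ‖x‖))
    (hK' : ∀ x, |f' x| ≤ K * Real.exp (C * ‖x‖))
    (hd : ∀ x, HasDerivAt (fun s : ℝ => f (x + s • v)) (f' x) 0) :
    Integrable (fun x => ⟪v, x⟫ * f x) (stdGaussian V) ∧ Integrable f' (stdGaussian V) ∧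
      ∫ x, ⟪v, x⟫ * f x ∂stdGaussian V = ∫ x, f' x ∂stdGaussian V := by
  have i1 : Integrable f (stdGaussian V) :=
    integrable_stdGaussian_of_le_exp hf.aestronglyMeasurable K C hK
  have i2 : Integrable f' (stdGaussian V) :=
    integrable_stdGaussian_of_le_exp hf'.aestronglyMeasurable K C hK'
  have i3 : Integrable (fun x => ⟪v, x⟫ * f x) (stdGaussian V) := by
    refine integrable_stdGaussian_of_le_exp (by fun_prop) (‖v‖ * K) (1 + C) fun x => ?_
    rw [abs_mul]
    calc |⟪v, x⟫| * |f x| ≤ (‖v‖ * Real.exp ‖x‖) * (K * Real.exp (C * ‖x‖)) := by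
          gcongr
          · refine (abs_real_inner_le_norm v x).trans ?_
            gcongr
            linarith [Real.add_one_le_exp ‖x‖]
          · exact hK x
      _ = _ := by rw [add_mul, Real.exp_add, one_mul]; ring
  refine ⟨i3, i2, ?_⟩
  rw [integrable_stdGaussian_iff] at i1 i2 i3
  simp_rw [integral_stdGaussian, smul_eq_mul]
  -- The density φ satisfies ∂_v φ = -⟪v, x⟫ φ, so integration by parts with respect to Lebesgue
  -- measure gives the identity.
  have key := integral_bilinear_hasLineDerivAt_right_eq_neg_left_of_integrable (μ := volume)
    (f := f) (f' := f') (g := (gaussDensity : V → ℝ)) (g' := fun x => -⟪v, x⟫ * gaussDensity x)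
    (v := v) (B := ContinuousLinearMap.mul ℝ ℝ) (by simpa [mul_comm] using i2)
    (by
      refine i3.neg.congr (ae_of_all _ fun x => ?_)
      simp; ring) (by simpa [mul_comm] using i1)
    (fun x _ => hd x) (fun x _ => by
      unfold HasLineDerivAt gaussDensity
      have h1 : HasDerivAt (fun t : ℝ => ‖x + t • v‖ ^ 2) (2 * ⟪x, v⟫) 0 := by
        have h2 : HasDerivAt (fun t : ℝ => x + t • v) v 0 := by
          simpa using ((hasDerivAt_id (0 : ℝ)).smul_const v).const_add x
        simpa using h2.norm_sq
      have h3 := ((h1.neg.div_const 2).exp).const_mul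
        ((2 * Real.pi) ^ (-(Module.finrank ℝ V : ℝ) / 2))
      convert! h3 using 1
      simp [real_inner_comm]
      ring)
  simp only [ContinuousLinearMap.mul_apply'] at key
  have e1 : ∀ x, gaussDensity x * (⟪v, x⟫ * f x) = -(f x * (-⟪v, x⟫ * gaussDensity x)) :=
    fun x => by ring
  simp_rw [e1]
  rw [integral_neg, key, neg_neg]
  simp_rw [mul_comm]

end Gaussian

/-! ### Exponential moments and the mean norm of a Gaussian vector -/

section GaussianMoments

variable {V : Type*} [NormedAddCommGroup V] [InnerProductSpace ℝ V] [FiniteDimensional ℝ V]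
  [MeasurableSpace V] [BorelSpace V]

/-- Completing the square turns the integrand into exp(‖w‖²/2) times the density translated by w. -/
lemma integral_exp_inner_stdGaussian (w : V) :
    ∫ x, Real.exp ⟪w, x⟫ ∂stdGaussian V = Real.exp (‖w‖ ^ 2 / 2) := by
  have h : ∀ x : V, gaussDensity x * Real.exp ⟪w, x⟫ =
      Real.exp (‖w‖ ^ 2 / 2) * gaussDensity (x - w) := by
    intro x
    unfold gaussDensity
    rw [mul_left_comm, mul_assoc, ← Real.exp_add, ← Real.exp_add, norm_sub_sq_real,
      real_inner_comm]
    congr 2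
    ring
  have h1 := integral_stdGaussian (V := V) (fun _ => (1 : ℝ))
  simp only [integral_const, probReal_univ, smul_eq_mul, mul_one] at h1
  rw [integral_stdGaussian]
  simp_rw [smul_eq_mul, h]
  rw [integral_const_mul, integral_sub_right_eq_self (fun x : V => gaussDensity x) w, ← h1, mul_one]

lemma lintegral_exp_inner_stdGaussian (w : V) :
    ∫⁻ x, ENNReal.ofReal (Real.exp ⟪w, x⟫) ∂stdGaussian V =
      ENNReal.ofReal (Real.exp (‖w‖ ^ 2 / 2)) := by
  rw [← integral_exp_inner_stdGaussian, ofReal_integral_eq_lintegral_ofReal]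
  · refine integrable_stdGaussian_of_le_exp (by fun_prop) 1 ‖w‖ fun x => ?_
    rw [one_mul, abs_of_pos (Real.exp_pos _), Real.exp_le_exp]
    exact real_inner_le_norm w x
  · exact ae_of_all _ fun x => (Real.exp_pos _).le

lemma lintegral_exp_sq_norm_stdGaussian {b : ℝ} (hb : b < 1) :
    ∫⁻ x, ENNReal.ofReal (Real.exp (b / 2 * ‖x‖ ^ 2)) ∂stdGaussian V =
      ENNReal.ofReal ((1 - b) ^ (-(Module.finrank ℝ V : ℝ) / 2)) := by
  have hb' : 0 < (1 - b) / 2 := by linarith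
  have h := GaussianFourier.integral_rexp_neg_mul_sq_norm (V := V) hb'
  have hi : Integrable fun x : V => Real.exp (-((1 - b) / 2) * ‖x‖ ^ 2) := by
    by_contra hc
    rw [integral_undef hc] at h
    have : 0 < (Real.pi / ((1 - b) / 2)) ^ ((Module.finrank ℝ V : ℝ) / 2) := by positivity
    linarith
  rw [stdGaussian_eq_withDensity, lintegral_withDensity_eq_lintegral_mul _
    (by exact continuous_gaussDensity.measurable.ennreal_ofReal) (by fun_prop)]
  have e : ∀ x : V, ((fun x : V => ENNReal.ofReal (gaussDensity x)) *
      fun x : V => ENNReal.ofReal (Real.exp (b / 2 * ‖x‖ ^ 2))) x =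
      ENNReal.ofReal ((2 * Real.pi) ^ (-(Module.finrank ℝ V : ℝ) / 2) *
        Real.exp (-((1 - b) / 2) * ‖x‖ ^ 2)) := by
    intro x
    simp only [Pi.mul_apply]
    rw [← ENNReal.ofReal_mul (gaussDensity_pos x).le, gaussDensity, mul_assoc, ← Real.exp_add]
    congr 3
    ring
  simp_rw [e]
  rw [← ofReal_integral_eq_lintegral_ofReal (hi.const_mul _)
    (ae_of_all _ fun x => by positivity), integral_const_mul, h]
  congr 1
  rw [show Real.pi / ((1 - b) / 2) = (2 * Real.pi) * (1 - b)⁻¹ by field_simp,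
    Real.mul_rpow (x := 2 * Real.pi) (y := (1 - b)⁻¹) (by positivity)
      (inv_nonneg.2 (by linarith)), ← mul_assoc,
    ← Real.rpow_add (by positivity), Real.inv_rpow (by linarith), ← Real.rpow_neg (by linarith)]
  simp [neg_div]

variable (V) in
/-- The mean norm of a standard Gaussian vector. -/
noncomputable def meanNorm : ℝ := ∫ x, ‖x‖ ∂stdGaussian V

/-- In polar coordinates the total mass 1 and the mean norm are radial integrals with the same
prefactor. Dividing one by the other removes the volume of the unit ball and the normalising
constant. -/
lemma meanNorm_eq [Nontrivial V] :
    meanNorm V = √2 * Real.Gamma (((Module.finrank ℝ V : ℝ) + 1) / 2) /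
      Real.Gamma ((Module.finrank ℝ V : ℝ) / 2) := by
  have hd : 1 ≤ Module.finrank ℝ V := Module.finrank_pos
  set d := Module.finrank ℝ V with hdd
  have hdR : (1 : ℝ) ≤ d := by exact_mod_cast hd
  have hK : ∀ q : ℝ, -1 < q → ∫ y in Set.Ioi (0 : ℝ), y ^ q * Real.exp (-(1 / 2) * y ^ (2 : ℝ)) =
      (1 / 2 : ℝ) ^ (-(q + 1) / 2) * (1 / 2) * Real.Gamma ((q + 1) / 2) := fun q hq =>
    integral_rpow_mul_exp_neg_mul_rpow (by norm_num) hq (by norm_num)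
  set c : ℝ := (2 * Real.pi) ^ (-(d : ℝ) / 2) with hc
  have h0 : (1 : ℝ) = d * (volume.real (Metric.ball (0 : V) 1) *
      (c * ((1 / 2 : ℝ) ^ (-(d : ℝ) / 2) * (1 / 2) * Real.Gamma ((d : ℝ) / 2)))) := by
    have h1 := integral_stdGaussian (V := V) (fun _ => (1 : ℝ))
    simp only [integral_const, probReal_univ, smul_eq_mul, mul_one] at h1
    have h2 := integral_fun_norm_addHaar (volume : Measure V)
      (fun y : ℝ => c * Real.exp (-y ^ 2 / 2))
    unfold gaussDensity at h1
    refine h1.trans ?_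
    rw [← hdd, ← hc, h2, ← hdd, nsmul_eq_mul, smul_eq_mul]
    congr 2
    have h3 := hK (d - 1) (by linarith)
    rw [show (d : ℝ) - 1 + 1 = d by ring] at h3
    rw [← h3, ← integral_const_mul]
    refine setIntegral_congr_fun measurableSet_Ioi fun y hy => ?_
    simp only [smul_eq_mul]
    rw [show ((d : ℝ) - 1) = ((d - 1 : ℕ) : ℝ) by push_cast [Nat.cast_sub hd]; ring,
      Real.rpow_natCast, show (2 : ℝ) = ((2 : ℕ) : ℝ) by norm_num, Real.rpow_natCast]
    push_cast
    rw [show -(1 / 2 : ℝ) * y ^ 2 = -y ^ 2 / 2 by ring]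
    ring
  have h1 : meanNorm V = d * (volume.real (Metric.ball (0 : V) 1) *
      (c * ((1 / 2 : ℝ) ^ (-((d : ℝ) + 1) / 2) * (1 / 2) * Real.Gamma (((d : ℝ) + 1) / 2)))) := by
    have h2 := integral_fun_norm_addHaar (volume : Measure V)
      (fun y : ℝ => c * Real.exp (-y ^ 2 / 2) * y)
    unfold meanNorm
    rw [integral_stdGaussian]
    unfold gaussDensity
    simp_rw [smul_eq_mul]
    rw [← hdd, ← hc, h2, ← hdd, nsmul_eq_mul, smul_eq_mul]
    congr 2
    have h3 := hK d (by linarith)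
    rw [← h3, ← integral_const_mul]
    refine setIntegral_congr_fun measurableSet_Ioi fun y hy => ?_
    simp only [smul_eq_mul]
    rw [Real.rpow_natCast, show (2 : ℝ) = ((2 : ℕ) : ℝ) by norm_num, Real.rpow_natCast]
    push_cast
    rw [show -(1 / 2 : ℝ) * y ^ 2 = -y ^ 2 / 2 by ring]
    have : y ^ d = y ^ (d - 1) * y := by rw [← pow_succ, Nat.sub_add_cancel hd]
    rw [this]
    ring
  have hG : 0 < Real.Gamma ((d : ℝ) / 2) := Real.Gamma_pos_of_pos (by linarith)
  have h4 : (1 / 2 : ℝ) ^ (-((d : ℝ) + 1) / 2) = (1 / 2 : ℝ) ^ (-(d : ℝ) / 2) * √2 := by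
    rw [show -((d : ℝ) + 1) / 2 = -(d : ℝ) / 2 + (-(1 / 2)) by ring, Real.rpow_add (by norm_num)]
    congr 1
    rw [Real.sqrt_eq_rpow, one_div (2 : ℝ), Real.inv_rpow (by norm_num),
      ← Real.rpow_neg (by norm_num), neg_neg]
  rw [eq_div_iff hG.ne', h1, h4]
  calc _ = (d * (volume.real (Metric.ball (0 : V) 1) *
      (c * ((1 / 2 : ℝ) ^ (-(d : ℝ) / 2) * (1 / 2) * Real.Gamma ((d : ℝ) / 2))))) *
        (√2 * Real.Gamma (((d : ℝ) + 1) / 2)) := by ring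
    _ = _ := by rw [← h0, one_mul]

/-- Log-convexity of Γ at a midpoint. Together with Γ(z + 1) = zΓ(z) it gives both bounds d - 1 ≤
(E‖g‖)² ≤ d. -/
lemma Gamma_midpoint_sq_le {s t : ℝ} (hs : 0 < s) (ht : 0 < t) :
    Real.Gamma ((s + t) / 2) ^ 2 ≤ Real.Gamma s * Real.Gamma t := by
  have h := Real.Gamma_mul_add_mul_le_rpow_Gamma_mul_rpow_Gamma hs ht (a := 1 / 2) (b := 1 / 2)
    (by norm_num) (by norm_num) (by norm_num)
  rw [show 1 / 2 * s + 1 / 2 * t = (s + t) / 2 by ring, ← Real.sqrt_eq_rpow,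
    ← Real.sqrt_eq_rpow, ← Real.sqrt_mul (Real.Gamma_pos_of_pos hs).le] at h
  have h0 : 0 < Real.Gamma ((s + t) / 2) := Real.Gamma_pos_of_pos (by linarith)
  have := pow_le_pow_left₀ h0.le h 2
  rwa [Real.sq_sqrt (mul_pos (Real.Gamma_pos_of_pos hs) (Real.Gamma_pos_of_pos ht)).le] at this

lemma meanNorm_pos [Nontrivial V] : 0 < meanNorm V := by
  rw [meanNorm_eq]
  have hd : (0 : ℝ) < Module.finrank ℝ V := by exact_mod_cast Module.finrank_pos
  have h1 := Real.Gamma_pos_of_pos (s := ((Module.finrank ℝ V : ℝ) + 1) / 2) (by linarith)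
  have h2 := Real.Gamma_pos_of_pos (s := (Module.finrank ℝ V : ℝ) / 2) (by linarith)
  positivity

lemma meanNorm_sq_le [Nontrivial V] : meanNorm V ^ 2 ≤ Module.finrank ℝ V := by
  have hd : (0 : ℝ) < Module.finrank ℝ V := by exact_mod_cast Module.finrank_pos
  rw [meanNorm_eq]
  set d : ℝ := (Module.finrank ℝ V : ℝ)
  have h2 := Real.Gamma_pos_of_pos (s := d / 2) (by linarith)
  have h := Gamma_midpoint_sq_le (s := d / 2) (t := d / 2 + 1) (by linarith) (by linarith)
  rw [Real.Gamma_add_one (by linarith), show (d / 2 + (d / 2 + 1)) / 2 = (d + 1) / 2 by ring] at h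
  rw [div_pow, div_le_iff₀ (by positivity), mul_pow, Real.sq_sqrt (by norm_num)]
  nlinarith

lemma finrank_sub_one_le_meanNorm_sq [Nontrivial V] :
    (Module.finrank ℝ V : ℝ) - 1 ≤ meanNorm V ^ 2 := by
  have hd : (1 : ℝ) ≤ Module.finrank ℝ V := by exact_mod_cast Module.finrank_pos
  rcases hd.eq_or_lt with h1 | h1
  -- Dimension 1 is treated apart because Γ would be evaluated at (d - 1)/2 = 0.
  · rw [← h1, sub_self]; positivity
  rw [meanNorm_eq]
  set d : ℝ := (Module.finrank ℝ V : ℝ)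
  have h2 := Real.Gamma_pos_of_pos (s := d / 2) (by linarith)
  have h3 := Real.Gamma_pos_of_pos (s := (d + 1) / 2) (by linarith)
  have h := Gamma_midpoint_sq_le (s := (d - 1) / 2) (t := (d + 1) / 2) (by linarith) (by linarith)
  have h4 : Real.Gamma ((d + 1) / 2) = (d - 1) / 2 * Real.Gamma ((d - 1) / 2) := by
    rw [← Real.Gamma_add_one (by linarith)]; congr 1; ring
  rw [show ((d - 1) / 2 + (d + 1) / 2) / 2 = d / 2 by ring] at h
  rw [div_pow, le_div_iff₀ (by positivity), mul_pow, Real.sq_sqrt (by norm_num)]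
  calc (d - 1) * Real.Gamma (d / 2) ^ 2
      ≤ (d - 1) * (Real.Gamma ((d - 1) / 2) * Real.Gamma ((d + 1) / 2)) := by
        gcongr
    _ = 2 * ((d - 1) / 2 * Real.Gamma ((d - 1) / 2)) * Real.Gamma ((d + 1) / 2) := by ring
    _ = _ := by rw [← h4]; ring

lemma meanNorm_real : meanNorm ℝ = √(2 / Real.pi) := by
  rw [meanNorm_eq]
  simp only [Module.finrank_self, Nat.cast_one]
  rw [show ((1 : ℝ) + 1) / 2 = 1 by norm_num, Real.Gamma_one, Real.Gamma_one_half_eq, mul_one,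
    ← Real.sqrt_div (by norm_num)]

/-- The Laplace transform of the absolute value of a standard Gaussian variable. -/
lemma lintegral_exp_neg_abs_stdGaussian_le {l : ℝ} (hl : 0 ≤ l) :
    ∫⁻ x : ℝ, ENNReal.ofReal (Real.exp (-(l * |x|))) ∂stdGaussian ℝ ≤
      ENNReal.ofReal (Real.exp (-(l * √(2 / Real.pi)) + l ^ 2 / 2)) := by
  have hn : Integrable (fun x : ℝ => |x|) (stdGaussian ℝ) :=
    integrable_stdGaussian_of_le_exp (by fun_prop) 1 1 fun x => by
      simp only [Real.norm_eq_abs, abs_abs]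
      linarith [Real.add_one_le_exp (1 * |x|)]
  have hs : Integrable (fun x : ℝ => x ^ 2) (stdGaussian ℝ) :=
    integrable_stdGaussian_of_le_exp (by fun_prop) 2 1 fun x => by
      have := Real.quadratic_le_exp_of_nonneg (abs_nonneg x)
      rw [abs_of_nonneg (sq_nonneg x)]
      simp only [Real.norm_eq_abs, one_mul]
      nlinarith [sq_abs x, abs_nonneg x]
  have hv : ∫ x : ℝ, x ^ 2 ∂stdGaussian ℝ = 1 := by
    have h := variance_dual_stdGaussian (E := ℝ) (ContinuousLinearMap.id ℝ ℝ)
    have h0 := integral_strongDual_stdGaussian (E := ℝ) (ContinuousLinearMap.id ℝ ℝ)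
    rw [variance_of_integral_eq_zero (by fun_prop) h0] at h
    simpa using h
  -- For y ≥ 0, e^{-y} ≤ 1 - y + y²/2, because e^y ≥ 1 + y + y²/2 and (1 - y + y²/2)(1 + y + y²/2) =
  -- 1 + y⁴/4 ≥ 1.
  have hb : ∀ x : ℝ, Real.exp (-(l * |x|)) ≤ 1 - l * |x| + l ^ 2 / 2 * x ^ 2 := by
    intro x
    have h0 : 0 ≤ l * |x| := by positivity
    have h1 := Real.quadratic_le_exp_of_nonneg h0
    have e : l ^ 2 / 2 * x ^ 2 = (l * |x|) ^ 2 / 2 := by rw [mul_pow, sq_abs]; ring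
    rw [e]
    generalize l * |x| = y at *
    have hp : 0 < 1 - y + y ^ 2 / 2 := by nlinarith [sq_nonneg (y - 1)]
    rw [Real.exp_neg, inv_le_comm₀ (Real.exp_pos _) hp]
    refine le_trans ?_ h1
    rw [← one_div, div_le_iff₀ hp]
    nlinarith [sq_nonneg (y ^ 2)]
  have hj : Integrable (fun x : ℝ => 1 - l * |x|) (stdGaussian ℝ) :=
    (integrable_const (1 : ℝ)).sub (hn.const_mul l)
  have hi : Integrable (fun x : ℝ => 1 - l * |x| + l ^ 2 / 2 * x ^ 2) (stdGaussian ℝ) :=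
    hj.add (hs.const_mul (l ^ 2 / 2))
  calc _ ≤ ∫⁻ x : ℝ, ENNReal.ofReal (1 - l * |x| + l ^ 2 / 2 * x ^ 2) ∂stdGaussian ℝ :=
        lintegral_mono fun x => ENNReal.ofReal_le_ofReal (hb x)
    _ = ENNReal.ofReal (1 - l * √(2 / Real.pi) + l ^ 2 / 2) := by
        rw [← ofReal_integral_eq_lintegral_ofReal hi
          (ae_of_all _ fun x => (Real.exp_pos _).le.trans (hb x))]
        congr 1
        have h1 : ∫ x : ℝ, |x| ∂stdGaussian ℝ = √(2 / Real.pi) := meanNorm_real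
        rw [integral_add hj (hs.const_mul _),
          integral_sub (integrable_const (1 : ℝ)) (hn.const_mul l), integral_const_mul,
          integral_const_mul, hv, h1]
        simp
    _ ≤ _ := by
        refine ENNReal.ofReal_le_ofReal ?_
        linarith [Real.add_one_le_exp (-(l * √(2 / Real.pi)) + l ^ 2 / 2)]

end GaussianMoments

/-! ### Kahane–Gordon interpolation for powers of sums of exponentials -/

section GaussianComparison

variable {H : Type*} [NormedAddCommGroup H] [InnerProductSpace ℝ H]
variable {ι : Type*} [Fintype ι]

/-- A sum of exponentials of the functions `w u + c ⟪A u, x⟫ + α ⟪B u, x⟫`. -/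
noncomputable def expSum (w : ι → ℝ) (c : ℝ → ℝ) (α : ℝ) (A B : ι → H) (x : H) : ℝ :=
  ∑ u, Real.exp (w u + c ⟪A u, x⟫ + α * ⟪B u, x⟫)

variable {w : ι → ℝ} {c c' : ℝ → ℝ} {α : ℝ} {A B : ι → H}

lemma exp_le_expSum (u : ι) (x : H) :
    Real.exp (w u + c ⟪A u, x⟫ + α * ⟪B u, x⟫) ≤ expSum w c α A B x :=
  Finset.single_le_sum (f := fun u => Real.exp (w u + c ⟪A u, x⟫ + α * ⟪B u, x⟫))
    (fun _ _ => (Real.exp_pos _).le) (Finset.mem_univ u)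

lemma expSum_pos [Nonempty ι] (x : H) : 0 < expSum w c α A B x :=
  Finset.sum_pos (fun _ _ => Real.exp_pos _) Finset.univ_nonempty

lemma continuous_expSum (hc : Continuous c) : Continuous (expSum w c α A B) := by
  unfold expSum
  fun_prop

lemma abs_sub_zero_le_of_deriv_le (hd : ∀ s, HasDerivAt c (c' s) s) (hb : ∀ s, |c' s| ≤ |α|)
    (s : ℝ) : |c s - c 0| ≤ |α| * |s| := by
  have h := Convex.norm_image_sub_le_of_norm_hasDerivWithin_le (f := c) (f' := c') (s := Set.univ)
    (C := |α|) (x := 0) (y := s) (fun s _ => (hd s).hasDerivWithinAt) (fun s _ => hb s)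
    convex_univ trivial trivial
  simpa using h

/-- As c is |α|-Lipschitz, every exponent grows at most linearly. This growth bound, uniform over
unit-ball families, justifies both the integrations by parts and differentiation under the integral.
-/
lemma expSum_le (hd : ∀ s, HasDerivAt c (c' s) s) (hb : ∀ s, |c' s| ≤ |α|)
    (hA : ∀ u, ‖A u‖ ≤ 1) (hB : ∀ u, ‖B u‖ ≤ 1) (x : H) :
    expSum w c α A B x ≤
      (Fintype.card ι * Real.exp (∑ u, |w u| + |c 0|)) * Real.exp (2 * |α| * ‖x‖) := by
  rw [mul_assoc, ← Real.exp_add, ← nsmul_eq_mul]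
  refine Finset.sum_le_card_nsmul _ _ _ fun u _ => Real.exp_le_exp.2 ?_
  have h1 : w u ≤ ∑ u, |w u| := (le_abs_self _).trans
    (Finset.single_le_sum (f := fun u => |w u|) (fun _ _ => abs_nonneg _) (Finset.mem_univ u))
  have hx : ∀ a : H, ‖a‖ ≤ 1 → |⟪a, x⟫| ≤ ‖x‖ := fun a ha =>
    (abs_real_inner_le_norm a x).trans (mul_le_of_le_one_left (norm_nonneg _) ha)
  have h2 : c ⟪A u, x⟫ ≤ |c 0| + |α| * ‖x‖ := by
    have h3 := (le_abs_self _).trans (abs_sub_zero_le_of_deriv_le hd hb ⟪A u, x⟫)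
    have h4 : |α| * |⟪A u, x⟫| ≤ |α| * ‖x‖ := by gcongr; exact hx _ (hA u)
    linarith [le_abs_self (c 0)]
  have h3 : α * ⟪B u, x⟫ ≤ |α| * ‖x‖ := by
    refine (le_abs_self _).trans ?_
    rw [abs_mul]
    gcongr
    exact hx _ (hB u)
  linarith

lemma rpow_expSum_le [Nonempty ι] (hd : ∀ s, HasDerivAt c (c' s) s) (hb : ∀ s, |c' s| ≤ |α|)
    (hA : ∀ u, ‖A u‖ ≤ 1) (hB : ∀ u, ‖B u‖ ≤ 1) {p : ℝ} (hp : 0 ≤ p) (x : H) :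
    expSum w c α A B x ^ p ≤
      (Fintype.card ι * Real.exp (∑ u, |w u| + |c 0|)) ^ p * Real.exp (2 * |α| * p * ‖x‖) := by
  refine (Real.rpow_le_rpow (expSum_pos x).le (expSum_le hd hb hA hB x) hp).trans_eq ?_
  rw [Real.mul_rpow (by positivity) (by positivity), ← Real.exp_mul]
  congr 2
  ring

lemma hasDerivAt_expSum_line (hd : ∀ s, HasDerivAt c (c' s) s) (x v : H) :
    HasDerivAt (fun s : ℝ => expSum w c α A B (x + s • v))
      (∑ u, Real.exp (w u + c ⟪A u, x⟫ + α * ⟪B u, x⟫) *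
        (c' ⟪A u, x⟫ * ⟪A u, v⟫ + α * ⟪B u, v⟫)) 0 := by
  unfold expSum
  refine HasDerivAt.fun_sum fun u _ => ?_
  have h1 : ∀ a : H, HasDerivAt (fun s : ℝ => ⟪a, x + s • v⟫) ⟪a, v⟫ 0 := by
    intro a
    simp_rw [inner_add_right, inner_smul_right]
    simpa using ((hasDerivAt_id (0 : ℝ)).mul_const ⟪a, v⟫).const_add ⟪a, x⟫
  have h2 : HasDerivAt (fun s : ℝ => c ⟪A u, x + s • v⟫) (c' ⟪A u, x⟫ * ⟪A u, v⟫) 0 :=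
    HasDerivAt.comp (h₂ := c) 0 (by simpa using hd ⟪A u, x⟫) (h1 (A u))
  have h3 := ((h2.const_add (w u)).add ((h1 (B u)).const_mul α)).exp
  simpa [add_assoc] using h3

lemma abs_sum_exp_mul_le (hb : ∀ s, |c' s| ≤ |α|) (a b : ι → ℝ) {C : ℝ}
    (ha : ∀ u, |a u| ≤ C) (hb' : ∀ u, |b u| ≤ C) (x : H) :
    |∑ u, Real.exp (w u + c ⟪A u, x⟫ + α * ⟪B u, x⟫) * (c' ⟪A u, x⟫ * a u + α * b u)| ≤
      expSum w c α A B x * (2 * |α| * C) := by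
  unfold expSum
  rw [Finset.sum_mul]
  refine (Finset.abs_sum_le_sum_abs _ _).trans (Finset.sum_le_sum fun u _ => ?_)
  rw [abs_mul, abs_of_pos (Real.exp_pos _)]
  gcongr
  refine (abs_add_le _ _).trans ?_
  rw [abs_mul, abs_mul]
  have h1 : |c' ⟪A u, x⟫| * |a u| ≤ |α| * C := 
    mul_le_mul (hb _) (ha u) (abs_nonneg _) (abs_nonneg _)
  have h2 : |α| * |b u| ≤ |α| * C := by gcongr; exact hb' u
  linarith

variable [FiniteDimensional ℝ H] [MeasurableSpace H] [BorelSpace H]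

/-- Integration by parts against one term of `expSum`. -/
lemma integral_inner_mul_expSum [Nonempty ι] (hd : ∀ s, HasDerivAt c (c' s) s)
    (hc' : Continuous c') (hb : ∀ s, |c' s| ≤ |α|)
    (hA : ∀ u, ‖A u‖ ≤ 1) (hB : ∀ u, ‖B u‖ ≤ 1) {p : ℝ} (hp : 0 ≤ p)
    (v : H) (hv : ‖v‖ ≤ 1) (u : ι) (hAv : ⟪A u, v⟫ = 0) (hBv : ⟪B u, v⟫ = 0)
    {h : H → ℝ} (hh : Continuous h) (hhb : ∀ x, |h x| ≤ |α|) (hhv : ∀ x (s : ℝ), h (x + s • v) = h x) :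
    Integrable (fun x => ⟪v, x⟫ * (expSum w c α A B x ^ (p - 1) *
        Real.exp (w u + c ⟪A u, x⟫ + α * ⟪B u, x⟫) * h x)) (stdGaussian H) ∧
    Integrable (fun x => (p - 1) * expSum w c α A B x ^ (p - 2) *
        (∑ u', Real.exp (w u' + c ⟪A u', x⟫ + α * ⟪B u', x⟫) *
          (c' ⟪A u', x⟫ * ⟪A u', v⟫ + α * ⟪B u', v⟫)) *
        Real.exp (w u + c ⟪A u, x⟫ + α * ⟪B u, x⟫) * h x) (stdGaussian H) ∧
    ∫ x, ⟪v, x⟫ * (expSum w c α A B x ^ (p - 1) *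
        Real.exp (w u + c ⟪A u, x⟫ + α * ⟪B u, x⟫) * h x) ∂stdGaussian H =
      ∫ x, (p - 1) * expSum w c α A B x ^ (p - 2) *
        (∑ u', Real.exp (w u' + c ⟪A u', x⟫ + α * ⟪B u', x⟫) *
          (c' ⟪A u', x⟫ * ⟪A u', v⟫ + α * ⟪B u', v⟫)) *
        Real.exp (w u + c ⟪A u, x⟫ + α * ⟪B u, x⟫) * h x ∂stdGaussian H := by
  have hcc : Continuous c := continuous_iff_continuousAt.2 fun s => (hd s).continuousAt
  have hz : Continuous (expSum w c α A B) := continuous_expSum hcc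
  have hzp : ∀ q : ℝ, Continuous fun x => expSum w c α A B x ^ q := fun q =>
    hz.rpow_const fun x => Or.inl (expSum_pos x).ne'
  set K := ((Fintype.card ι * Real.exp (∑ u, |w u| + |c 0|)) ^ p) with hK
  have hKp : 0 ≤ K := by positivity
  have hzb := rpow_expSum_le (w := w) hd hb hA hB hp
  have hip : ∀ a : H, ‖a‖ ≤ 1 → |⟪a, v⟫| ≤ 1 := fun a ha =>
    (abs_real_inner_le_norm a v).trans (mul_le_one₀ ha (norm_nonneg _) hv)
  -- One constant must dominate both the function and its derivative: K|α| serves the former, K|α||p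
  -- - 1|·2|α| the latter, and their sum is supplied.
  refine integral_inner_mul_stdGaussian v (((hzp _).mul (by fun_prop)).mul hh)
    (((((continuous_const.mul (hzp _)).mul (by fun_prop)).mul (by fun_prop)).mul hh))
    (K * |α| * (1 + |p - 1| * (2 * |α|))) (2 * |α| * p) (fun x => ?_) (fun x => ?_) (fun x => ?_)
  · have hzx := expSum_pos (w := w) (c := c) (α := α) (A := A) (B := B) x
    rw [abs_mul, abs_mul, abs_of_pos (Real.exp_pos _), abs_of_pos (by positivity)]
    calc _ ≤ expSum w c α A B x ^ (p - 1) * expSum w c α A B x * |α| := by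
          refine mul_le_mul ?_ (hhb x) (abs_nonneg _) (by positivity)
          gcongr
          exact exp_le_expSum u x
      _ = expSum w c α A B x ^ p * |α| := by
          rw [← Real.rpow_add_one hzx.ne', sub_add_cancel]
      _ ≤ (K * Real.exp (2 * |α| * p * ‖x‖)) * |α| := by
          gcongr
          exact hzb x
      _ = K * |α| * (1 + 0) * Real.exp (2 * |α| * p * ‖x‖) := by ring
      _ ≤ _ := by
          gcongr
          positivity
  · have hzx := expSum_pos (w := w) (c := c) (α := α) (A := A) (B := B) x
    rw [abs_mul, abs_mul, abs_mul, abs_mul, abs_of_pos (Real.exp_pos _),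
      abs_of_pos (a := _ ^ (p - 2)) (by positivity)]
    calc _ ≤ |p - 1| * expSum w c α A B x ^ (p - 2) * (expSum w c α A B x * (2 * |α| * 1)) *
          expSum w c α A B x * |α| := by
          refine mul_le_mul ?_ (hhb x) (abs_nonneg _) (by positivity)
          gcongr
          · exact abs_sum_exp_mul_le hb _ _ (fun u => hip _ (hA u)) (fun u => hip _ (hB u)) x
          · exact exp_le_expSum u x
      _ = |p - 1| * (expSum w c α A B x ^ (p - 2) * expSum w c α A B x *
          expSum w c α A B x) * (2 * |α|) * |α| := by ring
      _ = |p - 1| * expSum w c α A B x ^ p * (2 * |α|) * |α| := by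
          rw [← Real.rpow_add_one hzx.ne', ← Real.rpow_add_one hzx.ne']
          ring_nf
      _ ≤ |p - 1| * (K * Real.exp (2 * |α| * p * ‖x‖)) * (2 * |α|) * |α| := by
          gcongr
          exact hzb x
      _ = K * |α| * (0 + |p - 1| * (2 * |α|)) * Real.exp (2 * |α| * p * ‖x‖) := by ring
      _ ≤ _ := by
          gcongr
          exact zero_le_one
  -- The term of index u and the factor h are constant along v, so only the power of `expSum` is
  -- differentiated.
  · have h1 : ∀ s : ℝ, Real.exp (w u + c ⟪A u, x + s • v⟫ + α * ⟪B u, x + s • v⟫) =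
        Real.exp (w u + c ⟪A u, x⟫ + α * ⟪B u, x⟫) := by
      intro s
      rw [inner_add_right, inner_add_right, inner_smul_right, inner_smul_right, hAv, hBv]
      simp
    simp_rw [h1, hhv]
    have h2 := (hasDerivAt_expSum_line (w := w) (α := α) (A := A) (B := B) hd x v).rpow_const
      (p := p - 1) (Or.inl (by simpa using (expSum_pos x).ne'))
    convert! (h2.mul_const _).mul_const _ using 1
    rw [zero_smul, add_zero, show p - 1 - 1 = p - 2 by ring]
    ring

omit [FiniteDimensional ℝ H] [MeasurableSpace H] [BorelSpace H] in
lemma hasDerivAt_expSum_param (hd : ∀ s, HasDerivAt c (c' s) s) {A A' B B' : ℝ → ι → H} {θ : ℝ}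
    (hA : ∀ u, HasDerivAt (fun t => A t u) (A' θ u) θ)
    (hB : ∀ u, HasDerivAt (fun t => B t u) (B' θ u) θ) (x : H) :
    HasDerivAt (fun t : ℝ => expSum w c α (A t) (B t) x)
      (∑ u, Real.exp (w u + c ⟪A θ u, x⟫ + α * ⟪B θ u, x⟫) *
        (c' ⟪A θ u, x⟫ * ⟪A' θ u, x⟫ + α * ⟪B' θ u, x⟫)) θ := by
  unfold expSum
  refine HasDerivAt.fun_sum fun u _ => ?_
  have h1 : HasDerivAt (fun t : ℝ => ⟪A t u, x⟫) ⟪A' θ u, x⟫ θ := by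
    simpa using (hA u).inner ℝ (hasDerivAt_const θ x)
  have h1' : HasDerivAt (fun t : ℝ => ⟪B t u, x⟫) ⟪B' θ u, x⟫ θ := by
    simpa using (hB u).inner ℝ (hasDerivAt_const θ x)
  have h2 : HasDerivAt (fun t : ℝ => c ⟪A t u, x⟫) (c' ⟪A θ u, x⟫ * ⟪A' θ u, x⟫) θ :=
    HasDerivAt.comp (h₂ := c) θ (hd ⟪A θ u, x⟫) h1
  exact ((h2.const_add (w u)).add (h1'.const_mul α)).exp

/-- Kahane–Gordon interpolation: if along a path the covariances of the linear forms `B` decrease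
by as much as those of `A` increase, the mean of a concave power of `expSum` is monotone. -/
lemma integral_rpow_expSum_mono [Nonempty ι] (hd : ∀ s, HasDerivAt c (c' s) s)
    (hc' : Continuous c') (hb : ∀ s, |c' s| ≤ |α|) {A A' B B' : ℝ → ι → H}
    (hA : ∀ t u, HasDerivAt (fun t => A t u) (A' t u) t)
    (hB : ∀ t u, HasDerivAt (fun t => B t u) (B' t u) t)
    (nA : ∀ t u, ‖A t u‖ ≤ 1) (nB : ∀ t u, ‖B t u‖ ≤ 1)
    (nA' : ∀ t u, ‖A' t u‖ ≤ 1) (nB' : ∀ t u, ‖B' t u‖ ≤ 1)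
    {k : ℝ → ι → ι → ℝ} (hAA : ∀ t u u', ⟪A t u', A' t u⟫ = k t u u')
    (hBB : ∀ t u u', ⟪B t u', B' t u⟫ = -k t u u') (hAB : ∀ t u u', ⟪A t u', B' t u⟫ = 0)
    (hBA : ∀ t u u', ⟪B t u', A' t u⟫ = 0) (hk0 : ∀ t u, k t u u = 0) {T : ℝ}
    (hT : 0 ≤ T) (hk : ∀ t ∈ Set.Icc 0 T, ∀ u u', 0 ≤ k t u u') {p : ℝ} (hp : 0 ≤ p)
    (hp1 : p ≤ 1) :
    ∫ x, expSum w c α (A 0) (B 0) x ^ p ∂stdGaussian H ≤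
      ∫ x, expSum w c α (A T) (B T) x ^ p ∂stdGaussian H := by
  have hcc : Continuous c := continuous_iff_continuousAt.2 fun s => (hd s).continuousAt
  have hzp : ∀ t (q : ℝ), Continuous fun x => expSum w c α (A t) (B t) x ^ q := fun t q =>
    (continuous_expSum hcc).rpow_const fun x => Or.inl (expSum_pos x).ne'
  set K := ((Fintype.card ι * Real.exp (∑ u, |w u| + |c 0|)) ^ p) with hK
  have hKp : 0 ≤ K := by positivity
  have hzb := fun t => rpow_expSum_le (w := w) hd hb (nA t) (nB t) hp
  let S : ℝ → H → ℝ := fun t x => ∑ u, Real.exp (w u + c ⟪A t u, x⟫ + α * ⟪B t u, x⟫) *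
        (c' ⟪A t u, x⟫ * ⟪A' t u, x⟫ + α * ⟪B' t u, x⟫)
  let D : ℝ → H → ℝ := fun t x => S t x * p * expSum w c α (A t) (B t) x ^ (p - 1)
  have hSc : ∀ t, Continuous (S t) := fun t => by fun_prop
  have hDc : ∀ t, Continuous (D t) := fun t => ((hSc t).mul continuous_const).mul (hzp t _)
  have hDb : ∀ t x, ‖D t x‖ ≤ p * K * (2 * |α|) * Real.exp ((2 * |α| * p + 1) * ‖x‖) := by
    intro t x
    have hzx := expSum_pos (w := w) (c := c) (α := α) (A := A t) (B := B t) x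
    have hx : ∀ a : H, ‖a‖ ≤ 1 → |⟪a, x⟫| ≤ ‖x‖ := fun a ha =>
      (abs_real_inner_le_norm a x).trans (mul_le_of_le_one_left (norm_nonneg _) ha)
    simp only [D, S, Real.norm_eq_abs]
    rw [abs_mul, abs_mul, abs_of_nonneg hp, abs_of_pos (a := _ ^ (p - 1)) (by positivity)]
    calc _ ≤ (expSum w c α (A t) (B t) x * (2 * |α| * ‖x‖)) * p *
          expSum w c α (A t) (B t) x ^ (p - 1) := by
          gcongr
          exact abs_sum_exp_mul_le hb _ _ (fun u => hx _ (nA' t u)) (fun u => hx _ (nB' t u)) x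
      _ = p * (expSum w c α (A t) (B t) x ^ (p - 1) * expSum w c α (A t) (B t) x) *
          (2 * |α|) * ‖x‖ := by ring
      _ = p * expSum w c α (A t) (B t) x ^ p * (2 * |α|) * ‖x‖ := by
          rw [← Real.rpow_add_one hzx.ne', sub_add_cancel]
      _ ≤ p * (K * Real.exp (2 * |α| * p * ‖x‖)) * (2 * |α|) * Real.exp ‖x‖ := by
          gcongr
          · exact hzb t x
          · linarith [Real.add_one_le_exp ‖x‖]
      _ = _ := by rw [add_mul, one_mul, Real.exp_add]; ring
  have hder : ∀ t, HasDerivAt (fun t => ∫ x, expSum w c α (A t) (B t) x ^ p ∂stdGaussian H)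
      (∫ x, D t x ∂stdGaussian H) t := fun t =>
    (hasDerivAt_integral_of_dominated_loc_of_deriv_le (s := Set.univ) Filter.univ_mem
      (Filter.Eventually.of_forall fun t => (hzp t p).aestronglyMeasurable)
      (integrable_stdGaussian_of_le_exp (hzp t p).aestronglyMeasurable K (2 * |α| * p) fun x => by
        rw [abs_of_nonneg (Real.rpow_nonneg (expSum_pos x).le _)]
        exact hzb t x)
      (hDc t).aestronglyMeasurable (ae_of_all _ fun x t _ => hDb t x)
      ((integrable_exp_norm_stdGaussian _).const_mul _)
      (ae_of_all _ fun x t _ => (hasDerivAt_expSum_param hd (hA t) (hB t) x).rpow_const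
        (Or.inl (expSum_pos x).ne'))).2
  refine monotoneOn_of_deriv_nonneg (convex_Icc 0 T)
    (fun t _ => (hder t).continuousAt.continuousWithinAt)
    (fun t _ => (hder t).differentiableAt.differentiableWithinAt) (fun t ht => ?_)
    (Set.left_mem_Icc.2 hT) (Set.right_mem_Icc.2 hT) hT
  rw [(hder t).deriv]
  rw [interior_Icc] at ht
  have hkt := hk t (Set.Ioo_subset_Icc_self ht)
  -- Since k t u u = 0, the velocities of A u and B u are orthogonal to A u and B u themselves, so
  -- the own term of u contributes no derivative.
  have h1 := fun u => integral_inner_mul_expSum (w := w) hd hc' hb (nA t) (nB t) hp (A' t u)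
    (nA' t u) u ((hAA t u u).trans (hk0 t u)) (hBA t u u) (h := fun x => c' ⟪A t u, x⟫)
    (by fun_prop) (fun x => hb _) (fun x s => by
      rw [inner_add_right, inner_smul_right, hAA, hk0, mul_zero, add_zero])
  have h2 := fun u => integral_inner_mul_expSum (w := w) hd hc' hb (nA t) (nB t) hp (B' t u)
    (nB' t u) u (hAB t u u) ((hBB t u u).trans (by rw [hk0, neg_zero])) (h := fun _ => α)
    (by fun_prop) (fun x => le_rfl) (fun x s => rfl)
  have hsum : ∀ F G : ι → H → ℝ, (∀ u, Integrable (F u) (stdGaussian H)) →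
      (∀ u, Integrable (G u) (stdGaussian H)) →
      ∑ u, (∫ x, F u x ∂stdGaussian H + ∫ x, G u x ∂stdGaussian H) =
        ∫ x, ∑ u, (F u x + G u x) ∂stdGaussian H := by
    intro F G hF hG
    have hFG : ∀ u, Integrable (fun x => F u x + G u x) (stdGaussian H) := fun u =>
      (hF u).add (hG u)
    rw [integral_finsetSum _ fun u _ => hFG u]
    exact Finset.sum_congr rfl fun u _ => (integral_add (hF u) (hG u)).symm
  have h3 : ∫ x, D t x ∂stdGaussian H = p * ∑ u,
      (∫ x, ⟪A' t u, x⟫ * (expSum w c α (A t) (B t) x ^ (p - 1) *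
        Real.exp (w u + c ⟪A t u, x⟫ + α * ⟪B t u, x⟫) * c' ⟪A t u, x⟫) ∂stdGaussian H +
      ∫ x, ⟪B' t u, x⟫ * (expSum w c α (A t) (B t) x ^ (p - 1) *
        Real.exp (w u + c ⟪A t u, x⟫ + α * ⟪B t u, x⟫) * α) ∂stdGaussian H) := by
    rw [hsum _ _ (fun u => (h1 u).1) (fun u => (h2 u).1), ← integral_const_mul]
    congr 1
    ext x
    simp only [D, S, Finset.sum_mul, Finset.mul_sum]
    refine Finset.sum_congr rfl fun u _ => ?_
    ring
  rw [h3]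
  refine mul_nonneg hp ?_
  simp_rw [fun u => (h1 u).2.2, fun u => (h2 u).2.2]
  rw [hsum _ _ (fun u => (h1 u).2.1) (fun u => (h2 u).2.1)]
  refine integral_nonneg fun x => ?_
  have hz2 : 0 ≤ expSum w c α (A t) (B t) x ^ (p - 2) := Real.rpow_nonneg (expSum_pos x).le _
  -- The A part carries c'c' k and the B part -α² k. With the factor p - 1 ≤ 0 their sum is (1 - p)
  -- k (α² - c'c'), nonnegative because |c'| ≤ |α|.
  have h4 : ∀ u, (p - 1) * expSum w c α (A t) (B t) x ^ (p - 2) *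
        (∑ u', Real.exp (w u' + c ⟪A t u', x⟫ + α * ⟪B t u', x⟫) *
          (c' ⟪A t u', x⟫ * ⟪A t u', A' t u⟫ + α * ⟪B t u', A' t u⟫)) *
        Real.exp (w u + c ⟪A t u, x⟫ + α * ⟪B t u, x⟫) * c' ⟪A t u, x⟫ +
      (p - 1) * expSum w c α (A t) (B t) x ^ (p - 2) *
        (∑ u', Real.exp (w u' + c ⟪A t u', x⟫ + α * ⟪B t u', x⟫) *
          (c' ⟪A t u', x⟫ * ⟪A t u', B' t u⟫ + α * ⟪B t u', B' t u⟫)) *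
        Real.exp (w u + c ⟪A t u, x⟫ + α * ⟪B t u, x⟫) * α =
      ((1 - p) * expSum w c α (A t) (B t) x ^ (p - 2) *
        Real.exp (w u + c ⟪A t u, x⟫ + α * ⟪B t u, x⟫)) *
        ∑ u', Real.exp (w u' + c ⟪A t u', x⟫ + α * ⟪B t u', x⟫) * k t u u' *
          (α * α - c' ⟪A t u', x⟫ * c' ⟪A t u, x⟫) := by
    intro u
    simp only [hAA, hBB, hAB, hBA, Finset.mul_sum, Finset.sum_mul, ← Finset.sum_add_distrib]
    refine Finset.sum_congr rfl fun u' _ => ?_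
    ring
  refine Finset.sum_nonneg fun u _ => ?_
  rw [h4 u]
  refine mul_nonneg (mul_nonneg (mul_nonneg (by linarith) hz2) (Real.exp_pos _).le)
    (Finset.sum_nonneg fun u' _ => mul_nonneg (mul_nonneg (Real.exp_pos _).le (hkt u u')) ?_)
  have h5 : c' ⟪A t u', x⟫ * c' ⟪A t u, x⟫ ≤ |α| * |α| := by
    refine (le_abs_self _).trans ?_
    rw [abs_mul]
    exact mul_le_mul (hb _) (hb _) (abs_nonneg _) (abs_nonneg _)
  rw [abs_mul_abs_self] at h5
  linarith

end GaussianComparison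

/-! ### Exchanging the roles of the two Gaussian families -/

section Gordon

lemma stdGaussian_prod {E F : Type*} [NormedAddCommGroup E] [InnerProductSpace ℝ E]
    [FiniteDimensional ℝ E] [MeasurableSpace E] [BorelSpace E] [NormedAddCommGroup F]
    [InnerProductSpace ℝ F] [FiniteDimensional ℝ F] [MeasurableSpace F] [BorelSpace F] :
    stdGaussian (WithLp 2 (E × F)) =
      ((stdGaussian E).prod (stdGaussian F)).map (WithLp.toLp 2) := by
  have : IsProbabilityMeasure (((stdGaussian E).prod (stdGaussian F)).map (WithLp.toLp 2)) :=
    Measure.isProbabilityMeasure_map (by fun_prop)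
  apply Measure.ext_of_charFun
  ext t
  rw [charFun_prod, charFun_stdGaussian, charFun_stdGaussian, charFun_stdGaussian,
    ← Complex.exp_add]
  congr 1
  have h := WithLp.prod_norm_sq_eq_of_L2 t
  have h' : (‖t‖ : ℂ) ^ 2 = (‖t.ofLp.1‖ : ℂ) ^ 2 + (‖t.ofLp.2‖ : ℂ) ^ 2 := by
    exact_mod_cast h
  rw [h']
  ring

variable {K : Type*} [NormedAddCommGroup K] [InnerProductSpace ℝ K] [FiniteDimensional ℝ K]
  [MeasurableSpace K] [BorelSpace K] {ι : Type*} [Fintype ι]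

/-- The comparison of the Gaussian families `(⟪p u, ·⟫, ⟪e, ·⟫)` and `(⟪e, ·⟫, ⟪p u, ·⟫)`. -/
lemma integral_rpow_expSum_swap_le [Nonempty ι] {w : ι → ℝ} {c c' : ℝ → ℝ} {α : ℝ}
    (hd : ∀ s, HasDerivAt c (c' s) s)
    (hc' : Continuous c') (hb : ∀ s, |c' s| ≤ |α|) {p : ι → K} {e : K} (hp : ∀ u, ‖p u‖ = 1)
    (he : ‖e‖ = 1) (hpe : ∀ u, ⟪p u, e⟫ = 0) {q : ℝ} (hq : 0 ≤ q) (hq1 : q ≤ 1) :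
    ∫ y, expSum w c α p (fun _ => e) y ^ q ∂stdGaussian K ≤
      ∫ y, expSum w c α (fun _ => e) p y ^ q ∂stdGaussian K := by
  have hcc : Continuous c := continuous_iff_continuousAt.2 fun s => (hd s).continuousAt
  let L : K → K → WithLp 2 (K × K) := fun x y => WithLp.toLp 2 (x, y)
  have hL : ∀ x y x' y', ⟪L x y, L x' y'⟫ = ⟪x, x'⟫ + ⟪y, y'⟫ := fun x y x' y' => by
    simp [L, WithLp.prod_inner_apply]
  have hLd : ∀ (f g : ℝ → ℝ) (f' g' t : ℝ) (x y : K), HasDerivAt f f' t → HasDerivAt g g' t →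
      HasDerivAt (fun t => L (f t • x) (g t • y)) (L (f' • x) (g' • y)) t := by
    intro f g f' g' t x y hf hg
    have h := (hf.smul_const x).prodMk (hg.smul_const y)
    exact ((WithLp.prodContinuousLinearEquiv 2 ℝ K K).symm.toContinuousLinearMap.hasFDerivAt
      ).comp_hasDerivAt t h
  have hpe' : ∀ u, ⟪e, p u⟫ = 0 := fun u => by rw [real_inner_comm, hpe]
  have hn : ∀ (s t : ℝ) (x y : K), ‖x‖ = 1 → ‖y‖ = 1 → s ^ 2 + t ^ 2 = 1 →
      ‖L (s • x) (t • y)‖ ≤ 1 := by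
    intro s t x y hx hy hst
    rw [← sq_le_one_iff₀ (norm_nonneg _), ← real_inner_self_eq_norm_sq, hL]
    simp only [inner_smul_left, inner_smul_right, real_inner_self_eq_norm_sq, hx, hy]
    simp only [conj_trivial]
    linarith
  have hee : ⟪e, e⟫ = 1 := by rw [real_inner_self_eq_norm_sq, he, one_pow]
  -- Two independent copies of the Gaussian vector are rotated through a quarter turn: A u goes from
  -- (p u, 0) to (0, e) and B u from (e, 0) to (0, p u). The covariances move by k = sin t cos t (1
  -- - ⟪p u', p u⟫), which is nonnegative on [0, π/2] and zero on the diagonal.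
  have key := integral_rpow_expSum_mono (w := w) (H := WithLp 2 (K × K)) hd hc' hb
    (A := fun t u => L (Real.cos t • p u) (Real.sin t • e))
    (A' := fun t u => L (-Real.sin t • p u) (Real.cos t • e))
    (B := fun t u => L (Real.cos t • e) (Real.sin t • p u))
    (B' := fun t u => L (-Real.sin t • e) (Real.cos t • p u))
    (k := fun t u u' => Real.sin t * Real.cos t * (1 - ⟪p u', p u⟫))
    (T := Real.pi / 2) (p := q)
    (fun t u => hLd _ _ _ _ t _ _ (Real.hasDerivAt_cos t) (Real.hasDerivAt_sin t))
    (fun t u => hLd _ _ _ _ t _ _ (Real.hasDerivAt_cos t) (Real.hasDerivAt_sin t))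
    (fun t u => hn _ _ _ _ (hp u) he (by simp))
    (fun t u => hn _ _ _ _ he (hp u) (by simp))
    (fun t u => hn _ _ _ _ (hp u) he (by simp))
    (fun t u => hn _ _ _ _ he (hp u) (by simp))
    (fun t u u' => by
      simp only [hL, inner_smul_left, inner_smul_right, hee, conj_trivial]; ring)
    (fun t u u' => by
      simp only [hL, inner_smul_left, inner_smul_right, hee, conj_trivial]; ring)
    (fun t u u' => by simp [hL, inner_smul_left, inner_smul_right, hpe, hpe'])
    (fun t u u' => by simp [hL, inner_smul_left, inner_smul_right, hpe, hpe'])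
    (fun t u => by rw [real_inner_self_eq_norm_sq, hp]; ring)
    (by positivity)
    (fun t ht u u' => by
      have h1 := Real.sin_nonneg_of_nonneg_of_le_pi ht.1 (by linarith [ht.2, Real.pi_pos])
      have h2 := Real.cos_nonneg_of_neg_pi_div_two_le_of_le
        (by linarith [ht.1, Real.pi_pos]) ht.2
      have h3 := real_inner_le_norm (p u') (p u)
      rw [hp, hp, one_mul] at h3
      have : 0 ≤ 1 - ⟪p u', p u⟫ := by linarith
      positivity)
    hq hq1
  have hm : ∀ A B : ι → WithLp 2 (K × K), StronglyMeasurable fun x =>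
      expSum w c α A B x ^ q := fun A B =>
    ((continuous_expSum hcc).rpow_const fun x => Or.inl (expSum_pos x).ne').stronglyMeasurable
  have e1 : ∀ y z : K, expSum w c α (fun u => L (Real.cos 0 • p u) (Real.sin 0 • e))
      (fun u => L (Real.cos 0 • e) (Real.sin 0 • p u)) (L y z) =
      expSum w c α p (fun _ => e) y := by
    intro y z
    unfold expSum
    simp [hL]
  have e2 : ∀ y z : K, expSum w c α (fun u => L (Real.cos (Real.pi / 2) • p u)
      (Real.sin (Real.pi / 2) • e)) (fun u => L (Real.cos (Real.pi / 2) • e)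
      (Real.sin (Real.pi / 2) • p u)) (L y z) =
      expSum w c α (fun _ => e) p z := by
    intro y z
    unfold expSum
    simp [hL]
  rw [stdGaussian_prod, integral_map (by fun_prop) (hm _ _).aestronglyMeasurable,
    integral_map (by fun_prop) (hm _ _).aestronglyMeasurable] at key
  have f1 := integral_fun_fst (μ := stdGaussian K) (ν := stdGaussian K)
    (fun y => expSum w c α p (fun _ => e) y ^ q)
  have f2 := integral_fun_snd (μ := stdGaussian K) (ν := stdGaussian K)
    (fun y => expSum w c α (fun _ => e) p y ^ q)
  simp only [probReal_univ, one_smul] at f1 f2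
  rw [← f1, ← f2]
  refine (Eq.le ?_).trans (key.trans (Eq.le ?_))
  · refine integral_congr_ae (ae_of_all _ fun x => ?_)
    simp only
    rw [← e1 x.1 x.2]
  · refine integral_congr_ae (ae_of_all _ fun x => ?_)
    simp only
    rw [← e2 x.1 x.2]

end Gordon

/-! ### From sums of exponentials to maxima -/

section GordonSup

variable {V : Type*} [NormedAddCommGroup V] [InnerProductSpace ℝ V] [FiniteDimensional ℝ V]
  [MeasurableSpace V] [BorelSpace V] {ι : Type*} [Fintype ι]

lemma lintegral_stdGaussian_prod_mul {f : V → ENNReal} {g : ℝ → ENNReal} (hf : Measurable f)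
    (hg : Measurable g) :
    ∫⁻ x, f (WithLp.ofLp x).1 * g (WithLp.ofLp x).2 ∂stdGaussian (WithLp 2 (V × ℝ)) =
      (∫⁻ x, f x ∂stdGaussian V) * ∫⁻ s, g s ∂stdGaussian ℝ := by
  rw [stdGaussian_prod, lintegral_map (by fun_prop) (by fun_prop)]
  exact lintegral_prod_mul hf.aemeasurable hg.aemeasurable

lemma lintegral_exp_mul_stdGaussian_real (l : ℝ) :
    ∫⁻ s : ℝ, ENNReal.ofReal (Real.exp (l * s)) ∂stdGaussian ℝ =
      ENNReal.ofReal (Real.exp (l ^ 2 / 2)) := by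
  have h := lintegral_exp_inner_stdGaussian (V := ℝ) l
  simpa [mul_comm] using h

lemma hasDerivAt_sqrt_sq_add {ε : ℝ} (hε : 0 < ε) (a s : ℝ) :
    HasDerivAt (fun s => a * √(s ^ 2 + ε ^ 2)) (a * (s / √(s ^ 2 + ε ^ 2))) s := by
  have h := (((hasDerivAt_pow 2 s).add_const (ε ^ 2)).sqrt (by positivity)).const_mul a
  convert! h using 2
  push_cast
  field_simp

/-- A finite-temperature form of the one-vector Gordon inequality. -/
lemma lintegral_iSup_exp_neg_abs_le_of_pos [Nonempty ι] {l : ℝ} (hl : 0 < l) (w : ι → ℝ)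
    {x : ι → V} (hx : ∀ u, ‖x u‖ = 1) {q : ℝ} (hq : 0 < q) (hq1 : q ≤ 1) :
    ENNReal.ofReal (Real.exp (-(l * q))) * ENNReal.ofReal (Real.exp (l ^ 2 / 2)) *
      ∫⁻ g, ⨆ u, ENNReal.ofReal (Real.exp (w u - l * |⟪x u, g⟫|)) ∂stdGaussian V ≤
    ENNReal.ofReal ((Fintype.card ι : ℝ) ^ q) *
      (∫⁻ s : ℝ, ENNReal.ofReal (Real.exp (-(l * |s|))) ∂stdGaussian ℝ) *
      ∫⁻ h, ⨆ u, ENNReal.ofReal (Real.exp (w u + l * ⟪x u, h⟫)) ∂stdGaussian V := by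
  -- Here q is a temperature: exponents are divided by q and the sum is raised to the power q, which
  -- approximates the maximum up to the factor |ι|^q. The smoothing √(s² + q²) of |s| costs at most
  -- q, whence the factor exp(-lq).
  set a : ℝ := l / q with ha
  have hap : 0 < a := by positivity
  let c : ℝ → ℝ := fun s => -a * √(s ^ 2 + q ^ 2)
  let c' : ℝ → ℝ := fun s => -a * (s / √(s ^ 2 + q ^ 2))
  have hd : ∀ s, HasDerivAt c (c' s) s := fun s => hasDerivAt_sqrt_sq_add hq (-a) s
  have hpos : ∀ s : ℝ, 0 < √(s ^ 2 + q ^ 2) := fun s => Real.sqrt_pos.2 (by positivity)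
  have habs : ∀ s : ℝ, |s| ≤ √(s ^ 2 + q ^ 2) := fun s => by
    rw [← Real.sqrt_sq_eq_abs]; exact Real.sqrt_le_sqrt (by nlinarith)
  have hle : ∀ s : ℝ, √(s ^ 2 + q ^ 2) ≤ |s| + q := fun s => by
    rw [Real.sqrt_le_left (by positivity)]
    nlinarith [sq_abs s, abs_nonneg s]
  have hcc : Continuous c := by fun_prop
  have hc' : Continuous c' :=
    continuous_const.mul (continuous_id.div (by fun_prop) fun s => (hpos s).ne')
  have hb : ∀ s, |c' s| ≤ |a| := fun s => by
    simp only [c']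
    rw [abs_mul, abs_neg, abs_div s, abs_of_pos (hpos s)]
    exact mul_le_of_le_one_right (abs_nonneg _) ((div_le_one (hpos s)).2 (habs s))
  let p : ι → WithLp 2 (V × ℝ) := fun u => WithLp.toLp 2 (x u, 0)
  let e : WithLp 2 (V × ℝ) := WithLp.toLp 2 (0, 1)
  have hp : ∀ u, ‖p u‖ = 1 := fun u => by
    rw [← sq_eq_sq₀ (norm_nonneg _) zero_le_one, WithLp.prod_norm_sq_eq_of_L2]
    simp [p, hx]
  have he : ‖e‖ = 1 := by
    rw [← sq_eq_sq₀ (norm_nonneg _) zero_le_one, WithLp.prod_norm_sq_eq_of_L2]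
    simp [e]
  have hpe : ∀ u, ⟪p u, e⟫ = 0 := fun u => by simp [p, e, WithLp.prod_inner_apply]
  have hpy : ∀ u (y : WithLp 2 (V × ℝ)), ⟪p u, y⟫ = ⟪x u, y.ofLp.1⟫ := fun u y => by
    simp [p, WithLp.prod_inner_apply]
  have hey : ∀ (y : WithLp 2 (V × ℝ)), ⟪e, y⟫ = y.ofLp.2 := fun y => by
    simp [e, WithLp.prod_inner_apply]
  have key := integral_rpow_expSum_swap_le (w := fun u => w u / q) (α := a) hd hc' hb hp he hpe
    hq.le hq1
  have hint : ∀ A B : ι → WithLp 2 (V × ℝ), (∀ u, ‖A u‖ ≤ 1) → (∀ u, ‖B u‖ ≤ 1) →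
      Integrable (fun y => expSum (fun u => w u / q) c a A B y ^ q)
        (stdGaussian (WithLp 2 (V × ℝ))) := fun A B hA hB =>
    integrable_stdGaussian_of_le_exp ((continuous_expSum hcc).rpow_const
      fun x => Or.inl (expSum_pos x).ne').aestronglyMeasurable _ _ fun y => by
        rw [abs_of_nonneg (Real.rpow_nonneg (expSum_pos y).le _)]
        exact rpow_expSum_le hd hb hA hB hq.le y
  have hnn : ∀ A B : ι → WithLp 2 (V × ℝ), ∀ y,
      0 ≤ expSum (fun u => w u / q) c a A B y ^ q := fun A B y =>
    Real.rpow_nonneg (expSum_pos y).le _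
  have key2 := ENNReal.ofReal_le_ofReal key
  rw [ofReal_integral_eq_lintegral_ofReal (hint _ _ (fun u => (hp u).le) (fun _ => he.le))
      (ae_of_all _ (hnn _ _)),
    ofReal_integral_eq_lintegral_ofReal (hint _ _ (fun u => he.le) (fun u => (hp u).le))
      (ae_of_all _ (hnn _ _))] at key2
  have hexp : ∀ t : ℝ, Real.exp t ^ q = Real.exp (t * q) := fun t => (Real.exp_mul t q).symm
  have haq : a * q = l := by rw [ha]; field_simp
  calc _ = ENNReal.ofReal (Real.exp (-(l * q))) *
        ∫⁻ y, (⨆ u, ENNReal.ofReal (Real.exp (w u - l * |⟪x u, y.ofLp.1⟫|))) *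
          ENNReal.ofReal (Real.exp (l * y.ofLp.2)) ∂stdGaussian (WithLp 2 (V × ℝ)) := by
        rw [lintegral_stdGaussian_prod_mul
          (f := fun g => ⨆ u, ENNReal.ofReal (Real.exp (w u - l * |⟪x u, g⟫|)))
          (g := fun s => ENNReal.ofReal (Real.exp (l * s))) (by fun_prop) (by fun_prop),
          lintegral_exp_mul_stdGaussian_real]
        ring
    _ = ∫⁻ y, ENNReal.ofReal (Real.exp (-(l * q))) *
          ((⨆ u, ENNReal.ofReal (Real.exp (w u - l * |⟪x u, y.ofLp.1⟫|))) *
          ENNReal.ofReal (Real.exp (l * y.ofLp.2))) ∂stdGaussian (WithLp 2 (V × ℝ)) := by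
        rw [lintegral_const_mul _ (by fun_prop)]
    _ ≤ _ := by
        refine lintegral_mono fun y => ?_
        rw [ENNReal.iSup_mul, ENNReal.mul_iSup]
        refine iSup_le fun u => ?_
        rw [← ENNReal.ofReal_mul (Real.exp_pos _).le, ← ENNReal.ofReal_mul (Real.exp_pos _).le,
          ← Real.exp_add, ← Real.exp_add]
        refine ENNReal.ofReal_le_ofReal ?_
        refine le_trans ?_ (Real.rpow_le_rpow (Real.exp_pos _).le (exp_le_expSum u y) hq.le)
        rw [hexp, Real.exp_le_exp, hpy, hey]
        have h1 : (w u / q + c ⟪x u, y.ofLp.1⟫ + a * y.ofLp.2) * q =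
            w u - l * √(⟪x u, y.ofLp.1⟫ ^ 2 + q ^ 2) + l * y.ofLp.2 := by
          simp only [c]
          rw [← haq]
          field_simp
          ring
        rw [h1]
        nlinarith [hle ⟪x u, y.ofLp.1⟫]
    _ ≤ _ := key2
    _ ≤ ∫⁻ y, ENNReal.ofReal ((Fintype.card ι : ℝ) ^ q) *
          ((⨆ u, ENNReal.ofReal (Real.exp (w u + l * ⟪x u, y.ofLp.1⟫))) *
          ENNReal.ofReal (Real.exp (-(l * |y.ofLp.2|)))) ∂stdGaussian (WithLp 2 (V × ℝ)) := by
        refine lintegral_mono fun y => ?_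
        obtain ⟨u, hu⟩ := Finite.exists_max fun u => w u + l * ⟪x u, y.ofLp.1⟫
        have h1 : ENNReal.ofReal (Real.exp (w u + l * ⟪x u, y.ofLp.1⟫)) ≤
            ⨆ u, ENNReal.ofReal (Real.exp (w u + l * ⟪x u, y.ofLp.1⟫)) :=
          le_iSup (fun u => ENNReal.ofReal (Real.exp (w u + l * ⟪x u, y.ofLp.1⟫))) u
        refine le_trans ?_ (mul_le_mul_right (mul_le_mul_left h1 _) _)
        rw [← ENNReal.ofReal_mul (Real.exp_pos _).le, ← Real.exp_add,
          ← ENNReal.ofReal_mul (by positivity)]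
        refine ENNReal.ofReal_le_ofReal ?_
        have h2 : expSum (fun u => w u / q) c a (fun _ => e) p y ≤ Fintype.card ι *
            Real.exp ((w u + l * ⟪x u, y.ofLp.1⟫ + -(l * |y.ofLp.2|)) / q) := by
          rw [← nsmul_eq_mul]
          refine Finset.sum_le_card_nsmul _ _ _ fun u' _ => Real.exp_le_exp.2 ?_
          rw [hpy, hey, le_div_iff₀ hq]
          have h3 : (w u' / q + c y.ofLp.2 + a * ⟪x u', y.ofLp.1⟫) * q =
              w u' - l * √(y.ofLp.2 ^ 2 + q ^ 2) + l * ⟪x u', y.ofLp.1⟫ := by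
            simp only [c]
            rw [← haq]
            field_simp
            ring
          rw [h3]
          nlinarith [habs y.ofLp.2, hu u']
        refine (Real.rpow_le_rpow (expSum_pos y).le h2 hq.le).trans_eq ?_
        rw [Real.mul_rpow (by positivity) (by positivity), hexp]
        field_simp
    _ = _ := by
        rw [lintegral_const_mul _ (by fun_prop), lintegral_stdGaussian_prod_mul
          (f := fun g => ⨆ u, ENNReal.ofReal (Real.exp (w u + l * ⟪x u, g⟫)))
          (g := fun s => ENNReal.ofReal (Real.exp (-(l * |s|)))) (by fun_prop) (by fun_prop)]
        ring

/-- The one-vector Gordon inequality for Laplace transforms. -/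
lemma lintegral_iSup_exp_neg_abs_le {l : ℝ} (hl : 0 < l) (w : ι → ℝ)
    {x : ι → V} (hx : ∀ u, ‖x u‖ = 1) :
    ∫⁻ g, ⨆ u, ENNReal.ofReal (Real.exp (w u - l * |⟪x u, g⟫|)) ∂stdGaussian V ≤
    ENNReal.ofReal (Real.exp (-(l * √(2 / Real.pi)))) *
      ∫⁻ h, ⨆ u, ENNReal.ofReal (Real.exp (w u + l * ⟪x u, h⟫)) ∂stdGaussian V := by
  rcases isEmpty_or_nonempty ι with hι | hι
  · simp
  set X := ∫⁻ g, ⨆ u, ENNReal.ofReal (Real.exp (w u - l * |⟪x u, g⟫|)) ∂stdGaussian V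
  set Y := ∫⁻ h, ⨆ u, ENNReal.ofReal (Real.exp (w u + l * ⟪x u, h⟫)) ∂stdGaussian V
  -- The factor exp(l²/2) from the auxiliary Gaussian variable on the left cancels the one in the
  -- bound for E exp(-l|s|). The remaining error factors tend to 1 along q = 1/(n + 1).
  have h1 : ∀ n : ℕ, X ≤ ENNReal.ofReal (Real.exp (l * (1 / ((n : ℝ) + 1))) *
      (Fintype.card ι : ℝ) ^ (1 / ((n : ℝ) + 1))) *
      (ENNReal.ofReal (Real.exp (-(l * √(2 / Real.pi)))) * Y) := by
    intro n
    have hn : (0 : ℝ) < 1 / ((n : ℝ) + 1) := by positivity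
    have h := lintegral_iSup_exp_neg_abs_le_of_pos hl w hx hn
      (by rw [div_le_one (by positivity)]; linarith [(Nat.cast_nonneg n : (0 : ℝ) ≤ n)])
    set q : ℝ := 1 / ((n : ℝ) + 1)
    calc X = ENNReal.ofReal (Real.exp (l * q) * Real.exp (-(l ^ 2 / 2))) *
          (ENNReal.ofReal (Real.exp (-(l * q))) * ENNReal.ofReal (Real.exp (l ^ 2 / 2)) * X) := by
          rw [← mul_assoc, ← ENNReal.ofReal_mul (Real.exp_pos _).le,
            ← ENNReal.ofReal_mul (by positivity), ← Real.exp_add, ← Real.exp_add, ← Real.exp_add]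
          ring_nf
          simp
      _ ≤ ENNReal.ofReal (Real.exp (l * q) * Real.exp (-(l ^ 2 / 2))) *
          (ENNReal.ofReal ((Fintype.card ι : ℝ) ^ q) *
          ENNReal.ofReal (Real.exp (-(l * √(2 / Real.pi)) + l ^ 2 / 2)) * Y) := by
          refine mul_le_mul_right (h.trans ?_) _
          gcongr
          exact lintegral_exp_neg_abs_stdGaussian_le hl.le
      _ = _ := by
          rw [← ENNReal.ofReal_mul (by positivity), ← mul_assoc, ← mul_assoc,
            ← ENNReal.ofReal_mul (by positivity), ← ENNReal.ofReal_mul (by positivity)]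
          congr 2
          rw [Real.exp_add, Real.exp_neg (l ^ 2 / 2)]
          field_simp
  have h2 : Filter.Tendsto (fun n : ℕ => ENNReal.ofReal (Real.exp (l * (1 / ((n : ℝ) + 1))) *
      (Fintype.card ι : ℝ) ^ (1 / ((n : ℝ) + 1))) *
      (ENNReal.ofReal (Real.exp (-(l * √(2 / Real.pi)))) * Y)) Filter.atTop
      (nhds (1 * (ENNReal.ofReal (Real.exp (-(l * √(2 / Real.pi)))) * Y))) := by
    refine ENNReal.Tendsto.mul_const ?_ (Or.inl one_ne_zero)
    have h3 := tendsto_one_div_add_atTop_nhds_zero_nat (𝕜 := ℝ)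
    have h4 : Continuous fun q : ℝ => ENNReal.ofReal (Real.exp (l * q) *
        (Fintype.card ι : ℝ) ^ q) := by
      refine ENNReal.continuous_ofReal.comp ((by fun_prop : Continuous fun q : ℝ =>
        Real.exp (l * q)).mul (Real.continuous_const_rpow ?_))
      exact_mod_cast Fintype.card_ne_zero
    have h5 := (h4.tendsto 0).comp h3
    rw [show ENNReal.ofReal (Real.exp (l * 0) * (Fintype.card ι : ℝ) ^ (0 : ℝ)) = 1 by simp] at h5
    exact h5
  rw [one_mul] at h2
  exact ge_of_tendsto' h2 h1

end GordonSup

/-! ### Uniform directions compared with Gaussian vectors -/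

section Polar

variable (V : Type*) [NormedAddCommGroup V] [InnerProductSpace ℝ V] [FiniteDimensional ℝ V]
  [MeasurableSpace V] [BorelSpace V]

instance [Nontrivial V] : IsProbabilityMeasure (sphereUniform V) := by
  have : IsProbabilityMeasure
      (((volume : Measure V).toSphere Set.univ)⁻¹ • (volume : Measure V).toSphere) := by
    refine ⟨?_⟩
    rw [Measure.smul_apply, smul_eq_mul]
    exact ENNReal.inv_mul_cancel (Measure.measure_univ_ne_zero.2 (Measure.toSphere_ne_zero _))
      (measure_ne_top _ _)
  exact Measure.isProbabilityMeasure_map (by fun_prop)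

lemma ae_norm_eq_one_sphereUniform : ∀ᵐ a ∂sphereUniform V, ‖a‖ = 1 := by
  rw [sphereUniform, ae_map_iff (by fun_prop)
    (measurableSet_eq_fun measurable_norm measurable_const)]
  exact ae_of_all _ fun a => by simp

/-- Polar decomposition of the standard Gaussian distribution. -/
lemma exists_radial_measure [Nontrivial V] :
    ∃ κ : Measure (Set.Ioi (0 : ℝ)), IsProbabilityMeasure κ ∧
      ∀ f : V → ENNReal, Measurable f →
        ∫⁻ x, f x ∂stdGaussian V = ∫⁻ a, ∫⁻ R, f ((R : ℝ) • a) ∂κ ∂sphereUniform V := by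
  set D : ℝ → ENNReal := fun R =>
    ENNReal.ofReal ((2 * Real.pi) ^ (-(Module.finrank ℝ V : ℝ) / 2) * Real.exp (-R ^ 2 / 2)) with hD
  have hDm : Measurable D := by fun_prop
  set σ := (volume : Measure V).toSphere with hσ
  set ν := Measure.volumeIoiPow (Module.finrank ℝ V - 1) with hν
  set s := σ Set.univ with hs
  have hs0 : s ≠ 0 := Measure.measure_univ_ne_zero.2 (Measure.toSphere_ne_zero _)
  have hst : s ≠ ⊤ := measure_ne_top _ _
  -- The area s of the sphere, divided out in `sphereUniform`, is restored in the radial law.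
  set κ : Measure (Set.Ioi (0 : ℝ)) := s • ν.withDensity fun R => D R with hκ
  have hsm : ∀ f : V → ENNReal, Measurable f → ∀ a : V,
      Measurable fun R : Set.Ioi (0 : ℝ) => f ((R : ℝ) • a) := fun f hf a =>
    hf.comp (by fun_prop)
  have : SFinite κ := by rw [hκ]; infer_instance
  have key : ∀ f : V → ENNReal, Measurable f →
      ∫⁻ x, f x ∂stdGaussian V = ∫⁻ a, ∫⁻ R, f ((R : ℝ) • a) ∂κ ∂sphereUniform V := by
    intro f hf
    have hfm : Measurable fun p : Metric.sphere (0 : V) 1 × Set.Ioi (0 : ℝ) =>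
        D p.2 * f ((p.2 : ℝ) • (p.1 : V)) := by
      refine (hDm.comp (by fun_prop)).mul (hf.comp (by fun_prop))
    have hg : ∀ x : V, ENNReal.ofReal (gaussDensity x) = D ‖x‖ := fun x => rfl
    have h1 : ∫⁻ x, f x ∂stdGaussian V = ∫⁻ x, D ‖x‖ * f x := by
      rw [stdGaussian_eq_withDensity, lintegral_withDensity_eq_lintegral_mul _
        (by exact continuous_gaussDensity.measurable.ennreal_ofReal) hf]
      rfl
    have h2 : ∫⁻ x, D ‖x‖ * f x = ∫⁻ a, ∫⁻ R, D R * f ((R : ℝ) • (a : V)) ∂ν ∂σ := by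
      rw [← lintegral_prod _ hfm.aemeasurable,
        ← (volume : Measure V).measurePreserving_homeomorphUnitSphereProd.lintegral_comp hfm,
        ← lintegral_add_compl _ (measurableSet_singleton (0 : V)),
        Measure.restrict_singleton, measure_singleton, zero_smul, lintegral_zero_measure, zero_add,
        ← lintegral_subtype_comap (measurableSet_singleton _).compl]
      refine lintegral_congr fun x => ?_
      have hx : ‖(x : V)‖ ≠ 0 := norm_ne_zero_iff.2 x.2
      simp [smul_smul, mul_inv_cancel₀ hx]
    rw [h1, h2, sphereUniform, lintegral_map ?_ (by fun_prop), lintegral_smul_measure]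
    · have h3 : ∀ a : Metric.sphere (0 : V) 1, ∫⁻ R, f ((R : ℝ) • (a : V)) ∂κ =
          s * ∫⁻ R, D R * f ((R : ℝ) • (a : V)) ∂ν := by
        intro a
        rw [hκ, lintegral_smul_measure, lintegral_withDensity_eq_lintegral_mul _
          (f := fun R : Set.Ioi (0 : ℝ) => D R) (by fun_prop) (hsm f hf a)]
        rfl
      simp_rw [h3]
      rw [lintegral_const_mul' _ _ hst, smul_eq_mul, ← mul_assoc, ENNReal.inv_mul_cancel hs0 hst,
        one_mul]
    · exact Measurable.lintegral_prod_right'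
        (f := fun p : V × Set.Ioi (0 : ℝ) => f ((p.2 : ℝ) • p.1)) (hf.comp (by fun_prop))
  refine ⟨κ, ⟨?_⟩, key⟩
  have h := key (fun _ => 1) measurable_const
  simpa using h.symm

variable {V}

/-- Averaging over the radius of a Gaussian vector: a maximum of exponentials of positively
homogeneous functions is, on the sphere of radius `meanNorm V`, at most its Gaussian mean. -/
lemma lintegral_sphereUniform_le_stdGaussian [Nontrivial V] {ι : Type*} [Fintype ι] (w : ι → ℝ)
    {ψ : ι → V → ℝ} (hψ : ∀ u, Measurable (ψ u))
    (hh : ∀ u (R : ℝ) (a : V), 0 < R → ψ u (R • a) = R * ψ u a) :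
    ∫⁻ a, ⨆ u, ENNReal.ofReal (Real.exp (w u + meanNorm V * ψ u a)) ∂sphereUniform V ≤
      ∫⁻ g, ⨆ u, ENNReal.ofReal (Real.exp (w u + ψ u g)) ∂stdGaussian V := by
  obtain ⟨κ, hκ, h⟩ := exists_radial_measure V
  -- The polar decomposition applied to the norm identifies the mean radius.
  have hm : ∫⁻ R, ENNReal.ofReal (R : ℝ) ∂κ = ENNReal.ofReal (meanNorm V) := by
    have h1 := h (fun x => ENNReal.ofReal ‖x‖) (by fun_prop)
    have hi : Integrable (fun x : V => ‖x‖) (stdGaussian V) :=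
      IsGaussian.integrable_id.norm
    rw [← ofReal_integral_eq_lintegral_ofReal hi (ae_of_all _ fun x => norm_nonneg x)] at h1
    rw [meanNorm, h1]
    have h2 : ∀ᵐ a ∂sphereUniform V, ∫⁻ R : Set.Ioi (0 : ℝ), ENNReal.ofReal ‖(R : ℝ) • a‖ ∂κ =
        ∫⁻ R, ENNReal.ofReal (R : ℝ) ∂κ := by
      filter_upwards [ae_norm_eq_one_sphereUniform V] with a ha
      refine lintegral_congr fun R => ?_
      rw [norm_smul, ha, mul_one, Real.norm_of_nonneg (le_of_lt R.2)]
    rw [lintegral_congr_ae h2]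
    simp
  have hR : Integrable (fun R : Set.Ioi (0 : ℝ) => (R : ℝ)) κ := by
    refine ⟨by fun_prop, ?_⟩
    rw [hasFiniteIntegral_iff_ofReal (ae_of_all _ fun R => le_of_lt R.2), hm]
    exact ENNReal.ofReal_lt_top
  have hRi : ∫ R : Set.Ioi (0 : ℝ), (R : ℝ) ∂κ = meanNorm V := by
    rw [integral_eq_lintegral_of_nonneg_ae (ae_of_all _ fun R => le_of_lt R.2) (by fun_prop), hm,
      ENNReal.toReal_ofReal meanNorm_pos.le]
  -- Jensen's inequality in the radius; when the exponential is not integrable the right side is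
  -- infinite.
  have hJ : ∀ k b : ℝ, ENNReal.ofReal (Real.exp (b + meanNorm V * k)) ≤
      ∫⁻ R : Set.Ioi (0 : ℝ), ENNReal.ofReal (Real.exp (b + R * k)) ∂κ := by
    intro k b
    by_cases hi : Integrable (fun R : Set.Ioi (0 : ℝ) => Real.exp (b + R * k)) κ
    · rw [← ofReal_integral_eq_lintegral_ofReal hi (ae_of_all _ fun R => (Real.exp_pos _).le)]
      refine ENNReal.ofReal_le_ofReal ?_
      have hl : Integrable (fun R : Set.Ioi (0 : ℝ) => b + R * k) κ :=
        (integrable_const b).add (hR.mul_const k)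
      have h1 := convexOn_exp.map_integral_le (μ := κ) Real.continuous_exp.continuousOn
        isClosed_univ (ae_of_all _ fun R => Set.mem_univ _) hl hi
      rw [integral_add (integrable_const b) (hR.mul_const k), integral_mul_const, hRi] at h1
      simpa using h1
    · have h2 : ∫⁻ R : Set.Ioi (0 : ℝ), ENNReal.ofReal (Real.exp (b + R * k)) ∂κ = ⊤ := by
        by_contra hc
        refine hi ⟨by fun_prop, ?_⟩
        rw [hasFiniteIntegral_iff_ofReal (ae_of_all _ fun R => (Real.exp_pos _).le)]
        exact lt_top_iff_ne_top.2 hc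
      rw [h2]
      exact le_top
  rw [h _ (by fun_prop)]
  refine lintegral_mono fun a => iSup_le fun u => (hJ (ψ u a) (w u)).trans ?_
  refine lintegral_mono fun R => ?_
  rw [← hh u R a R.2]
  exact le_iSup (fun u => ENNReal.ofReal (Real.exp (w u + ψ u ((R : ℝ) • a)))) u

/-- One uniform direction, compared with one Gaussian vector. -/
lemma lintegral_sphereUniform_iSup_le [Nontrivial V] {ι : Type*} [Fintype ι] {l : ℝ} (hl : 0 < l)
    (w : ι → ℝ) {x : ι → V} (hx : ∀ u, ‖x u‖ = 1) :
    ∫⁻ a, ⨆ u, ENNReal.ofReal (Real.exp (w u - l * meanNorm V * |⟪x u, a⟫|)) ∂sphereUniform V ≤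
    ENNReal.ofReal (Real.exp (-(l * √(2 / Real.pi)))) *
      ∫⁻ h, ⨆ u, ENNReal.ofReal (Real.exp (w u + l * ⟪x u, h⟫)) ∂stdGaussian V := by
  refine le_trans ?_ (lintegral_iSup_exp_neg_abs_le hl w hx)
  have h := lintegral_sphereUniform_le_stdGaussian w (ψ := fun u a => -(l * |⟪x u, a⟫|))
    (fun u => by fun_prop) (fun u R a hR => by
      simp only [inner_smul_right, abs_mul, abs_of_pos hR]; ring)
  refine (Eq.le ?_).trans (h.trans (Eq.le ?_))
  · congr! 6; ring
  · congr! 6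

/-- Jensen over the radius, applied to w divided by the mean norm ρ, gives exp(‖w‖²/(2ρ²)), and ρ² ≥
d - 1. -/
lemma lintegral_exp_inner_sphereUniform_le [Nontrivial V] (hd : 2 ≤ Module.finrank ℝ V) (w : V) :
    ∫⁻ a, ENNReal.ofReal (Real.exp ⟪w, a⟫) ∂sphereUniform V ≤
      ENNReal.ofReal (Real.exp (‖w‖ ^ 2 / (2 * ((Module.finrank ℝ V : ℝ) - 1)))) := by
  have hρ := meanNorm_pos (V := V)
  have h := lintegral_sphereUniform_le_stdGaussian (V := V) (ι := Unit) (fun _ => 0)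
    (ψ := fun _ a => ⟪(meanNorm V)⁻¹ • w, a⟫) (fun u => by fun_prop)
    (fun u R a _ => by rw [inner_smul_right])
  simp only [zero_add, iSup_const, lintegral_exp_inner_stdGaussian] at h
  refine (Eq.le ?_).trans (h.trans (ENNReal.ofReal_le_ofReal (Real.exp_le_exp.2 ?_)))
  · refine lintegral_congr fun a => ?_
    rw [inner_smul_left, conj_trivial, mul_inv_cancel_left₀ hρ.ne']
  · have hdR : (2 : ℝ) ≤ Module.finrank ℝ V := by exact_mod_cast hd
    have h1 := finrank_sub_one_le_meanNorm_sq (V := V)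
    rw [norm_smul, mul_pow, norm_inv, inv_pow, Real.norm_of_nonneg hρ.le, ← div_eq_inv_mul,
      div_div, mul_comm _ (2 : ℝ)]
    refine div_le_div_of_nonneg_left (sq_nonneg _) (by linarith) (by linarith)

end Polar

/-! ### Passing from one vector to independent copies -/

section Tensorization

/-- An inequality between Laplace transforms of maxima, valid for all offsets, tensorizes. -/
lemma lintegral_pi_iSup_exp_le {E F ι : Type*} [MeasurableSpace E] [MeasurableSpace F] [Fintype ι]
    {ν : Measure E} {γ : Measure F} [SigmaFinite ν] [SigmaFinite γ] {φ : ι → E → ℝ} {ψ : ι → F → ℝ}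
    (hφ : ∀ u, Measurable (φ u)) (hψ : ∀ u, Measurable (ψ u)) {C : ENNReal}
    (h : ∀ w : ι → ℝ, ∫⁻ a, ⨆ u, ENNReal.ofReal (Real.exp (w u + φ u a)) ∂ν ≤
      C * ∫⁻ b, ⨆ u, ENNReal.ofReal (Real.exp (w u + ψ u b)) ∂γ) (n : ℕ) (w : ι → ℝ) :
    ∫⁻ a, ⨆ u, ENNReal.ofReal (Real.exp (w u + ∑ j, φ u (a j))) ∂Measure.pi (fun _ : Fin n => ν) ≤
      C ^ n * ∫⁻ b, ⨆ u, ENNReal.ofReal (Real.exp (w u + ∑ j, ψ u (b j)))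
        ∂Measure.pi (fun _ : Fin n => γ) := by
  induction n generalizing w with
  | zero => simp
  | succ n ih =>
    rw [← ((measurePreserving_piFinSuccAbove (fun _ : Fin (n + 1) => ν) 0).symm).lintegral_comp
        (by fun_prop),
      ← ((measurePreserving_piFinSuccAbove (fun _ : Fin (n + 1) => γ) 0).symm).lintegral_comp
        (by fun_prop), lintegral_prod_symm' _ (by fun_prop), lintegral_prod _ (by fun_prop)]
    simp only [MeasurableEquiv.piFinSuccAbove_symm_apply, Fin.insertNthEquiv_zero,
      Fin.consEquiv_apply, Fin.sum_univ_succ, Fin.cons_zero, Fin.cons_succ]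
    -- The first coordinate is exchanged with the others frozen into the offset; then the induction
    -- hypothesis exchanges the rest, with the new first coordinate in the offset.
    calc _ ≤ ∫⁻ y, C * ∫⁻ b, ⨆ u, ENNReal.ofReal (Real.exp ((w u + ∑ j, φ u (y j)) + ψ u b)) ∂γ
          ∂Measure.pi (fun _ : Fin n => ν) := by
          refine lintegral_mono fun y => (Eq.le ?_).trans (h fun u => w u + ∑ j, φ u (y j))
          refine lintegral_congr fun x => iSup_congr fun u => ?_
          rw [add_comm (φ u x), add_assoc]
      _ = C * ∫⁻ b, ∫⁻ y, ⨆ u, ENNReal.ofReal (Real.exp ((w u + ψ u b) + ∑ j, φ u (y j)))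
          ∂Measure.pi (fun _ : Fin n => ν) ∂γ := by
          rw [lintegral_const_mul, lintegral_lintegral_swap]
          · congr 1
            refine lintegral_congr fun b => lintegral_congr fun y => iSup_congr fun u => ?_
            rw [add_right_comm]
          · exact Measurable.aemeasurable (by fun_prop)
          · exact Measurable.lintegral_prod_right' (f := fun p : (Fin n → E) × F =>
              ⨆ u, ENNReal.ofReal (Real.exp ((w u + ∑ j, φ u (p.1 j)) + ψ u p.2))) (by fun_prop)
      _ ≤ C * ∫⁻ b, C ^ n * ∫⁻ y, ⨆ u, ENNReal.ofReal (Real.exp ((w u + ψ u b) + ∑ j, ψ u (y j)))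
          ∂Measure.pi (fun _ : Fin n => γ) ∂γ := by
          gcongr with b
          exact ih fun u => w u + ψ u b
      _ = _ := by
          rw [lintegral_const_mul, pow_succ', mul_assoc]
          · congr 2
            refine lintegral_congr fun b => lintegral_congr fun y => iSup_congr fun u => ?_
            rw [add_assoc]
          · exact Measurable.lintegral_prod_right' (f := fun p : F × (Fin n → F) =>
              ⨆ u, ENNReal.ofReal (Real.exp ((w u + ψ u p.1) + ∑ j, ψ u (p.2 j)))) (by fun_prop)

lemma lintegral_pi_exp_sum_le {E : Type*} [MeasurableSpace E] {ν : Measure E} [SigmaFinite ν]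
    {f : E → ℝ} (hf : Measurable f) {c : ℝ}
    (h : ∫⁻ a, ENNReal.ofReal (Real.exp (f a)) ∂ν ≤ ENNReal.ofReal (Real.exp c)) (n : ℕ) :
    ∫⁻ a, ENNReal.ofReal (Real.exp (∑ j, f (a j))) ∂Measure.pi (fun _ : Fin n => ν) ≤
      ENNReal.ofReal (Real.exp (n * c)) := by
  -- With a single index and a point mass as comparison measure, tensorization reduces to
  -- multiplying the constants C = e^c.
  have h1 := lintegral_pi_iSup_exp_le (ι := Unit) (ν := ν) (γ := Measure.dirac ()) (φ := fun _ => f)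
    (ψ := fun _ _ => 0) (fun _ => hf) (fun _ => measurable_const)
    (C := ENNReal.ofReal (Real.exp c)) (fun w => by
      simp only [add_zero, Real.exp_add, lintegral_const, measure_univ, mul_one]
      simp_rw [ENNReal.ofReal_mul (Real.exp_pos _).le, ciSup_unique]
      rw [lintegral_const_mul _ (by fun_prop), mul_comm]
      gcongr) n (fun _ => 0)
  simpa [← ENNReal.ofReal_pow (Real.exp_pos _).le, ← Real.exp_nat_mul] using h1

end Tensorization

/-! ### Norms of sub-Gaussian vectors -/

section SubGaussian

variable {V : Type*} [NormedAddCommGroup V] [InnerProductSpace ℝ V] [FiniteDimensional ℝ V]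
  [MeasurableSpace V] [BorelSpace V] {T : Type*} [MeasurableSpace T] {μ : Measure T} [SFinite μ]
  {X : T → V}

/-- Exponential square moments of a sub-Gaussian vector. -/
lemma lintegral_exp_sq_norm_le_of_subgaussian (hX : Measurable X) {s : ℝ} (hs : 0 < s)
    (h : ∀ w : V, ∫⁻ t, ENNReal.ofReal (Real.exp ⟪w, X t⟫) ∂μ ≤
      ENNReal.ofReal (Real.exp (s * ‖w‖ ^ 2 / 2))) {b : ℝ} (hb : 0 ≤ b) (hb1 : b < 1) :
    ∫⁻ t, ENNReal.ofReal (Real.exp (b / (2 * s) * ‖X t‖ ^ 2)) ∂μ ≤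
      ENNReal.ofReal ((1 - b) ^ (-(Module.finrank ℝ V : ℝ) / 2)) := by
  rw [← lintegral_exp_sq_norm_stdGaussian hb1]
  -- Gaussian linearisation: exp(‖z‖²/2) is the mean of exp⟪z, g⟫. After Fubini the hypothesis
  -- applies for each fixed g.
  have e1 : ∀ t, ENNReal.ofReal (Real.exp (b / (2 * s) * ‖X t‖ ^ 2)) =
      ∫⁻ g, ENNReal.ofReal (Real.exp ⟪√(b / s) • X t, g⟫) ∂stdGaussian V := by
    intro t
    rw [lintegral_exp_inner_stdGaussian, norm_smul, mul_pow, Real.norm_of_nonneg (Real.sqrt_nonneg _),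
      Real.sq_sqrt (by positivity)]
    congr 2
    field_simp
  simp_rw [e1]
  rw [lintegral_lintegral_swap (Measurable.aemeasurable (by fun_prop))]
  refine lintegral_mono fun g => ?_
  have h1 := h (√(b / s) • g)
  rw [norm_smul, mul_pow, Real.norm_of_nonneg (Real.sqrt_nonneg _),
      Real.sq_sqrt (by positivity)] at h1
  refine (Eq.le (lintegral_congr fun t => ?_)).trans (h1.trans (Eq.le ?_))
  · rw [inner_smul_left, inner_smul_left, real_inner_comm]
  · congr 2
    field_simp

/-- Exponential moments of the norm of a sub-Gaussian vector. -/
lemma lintegral_exp_norm_le_of_subgaussian [Nontrivial V] (hX : Measurable X) {s : ℝ} (hs : 0 < s)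
    (h : ∀ w : V, ∫⁻ t, ENNReal.ofReal (Real.exp ⟪w, X t⟫) ∂μ ≤
      ENNReal.ofReal (Real.exp (s * ‖w‖ ^ 2 / 2))) {l : ℝ} (hl : 0 < l) :
    ∫⁻ t, ENNReal.ofReal (Real.exp (l * ‖X t‖)) ∂μ ≤
      ENNReal.ofReal (Real.exp (s * l ^ 2 / 2 + l * √(s * Module.finrank ℝ V))) := by
  have hd : (0 : ℝ) < Module.finrank ℝ V := by exact_mod_cast Module.finrank_pos
  set d : ℝ := (Module.finrank ℝ V : ℝ) with hdd
  set y := √(s * d) with hy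
  have hyp : 0 < y := Real.sqrt_pos.2 (by positivity)
  have hy2 : y ^ 2 = s * d := Real.sq_sqrt (by positivity)
  -- The linear exponent is bounded by l‖X‖ ≤ lr/2 + l‖X‖²/(2r). This r gives 1 - sl/r = y/r = (1 +
  -- sl/y)⁻¹, and then (1 + sl/y)^{d/2} ≤ exp(ly/2) because y² = sd.
  set r := s * l + y with hr
  have hrp : 0 < r := by positivity
  have hb1 : s * l / r < 1 := by rw [div_lt_one hrp]; linarith
  have h1 := lintegral_exp_sq_norm_le_of_subgaussian hX hs h (b := s * l / r) (by positivity) hb1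
  calc _ ≤ ∫⁻ t, ENNReal.ofReal (Real.exp (l * r / 2)) *
        ENNReal.ofReal (Real.exp (s * l / r / (2 * s) * ‖X t‖ ^ 2)) ∂μ := by
        refine lintegral_mono fun t => ?_
        rw [← ENNReal.ofReal_mul (Real.exp_pos _).le, ← Real.exp_add]
        refine ENNReal.ofReal_le_ofReal (Real.exp_le_exp.2 ?_)
        have e : l * r / 2 + s * l / r / (2 * s) * ‖X t‖ ^ 2 - l * ‖X t‖ =
          l / (2 * r) * (‖X t‖ - r) ^ 2 := by field_simp; ring
        have : 0 ≤ l / (2 * r) * (‖X t‖ - r) ^ 2 := by positivity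
        linarith
    _ ≤ ENNReal.ofReal (Real.exp (l * r / 2)) *
        ENNReal.ofReal ((1 - s * l / r) ^ (-d / 2)) := by
        rw [lintegral_const_mul _ (by fun_prop)]
        gcongr
    _ ≤ ENNReal.ofReal (Real.exp (l * r / 2)) * ENNReal.ofReal (Real.exp (l * y / 2)) := by
        gcongr
        have e : 1 - s * l / r = (1 + s * l / y)⁻¹ := by
          rw [hr]; field_simp; ring
        rw [e, Real.inv_rpow (by positivity), ← Real.rpow_neg (by positivity)]
        have h2 : 1 + s * l / y ≤ Real.exp (s * l / y) := by
          linarith [Real.add_one_le_exp (s * l / y)]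
        refine (Real.rpow_le_rpow (by positivity) h2 (by rw [neg_div, neg_neg]; positivity)).trans_eq
          ?_
        rw [← Real.exp_mul]
        congr 1
        field_simp
        rw [hy2]
    _ = _ := by
        rw [← ENNReal.ofReal_mul (Real.exp_pos _).le, ← Real.exp_add, hr]
        congr 2
        ring

end SubGaussian

/-! ### The permeance of uniform directions -/

section Permeance

variable {V : Type*} [NormedAddCommGroup V] [InnerProductSpace ℝ V] [FiniteDimensional ℝ V]
  [MeasurableSpace V] [BorelSpace V]

/-- After tensorization the maximum on the Gaussian side is at most exp(l‖Σ h_j‖), and Σ h_j is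
sub-Gaussian with variance proxy n. -/
lemma lintegral_pi_sphereUniform_iSup_le [Nontrivial V] {ι : Type*} [Fintype ι] {l : ℝ} (hl : 0 < l)
    {x : ι → V} (hx : ∀ u, ‖x u‖ = 1) {n : ℕ} (hn : 0 < n) :
    ∫⁻ a, ⨆ u, ENNReal.ofReal (Real.exp (∑ j, -(l * meanNorm V * |⟪x u, a j⟫|)))
        ∂Measure.pi (fun _ : Fin n => sphereUniform V) ≤
      ENNReal.ofReal (Real.exp (-(n * (l * √(2 / Real.pi))) + (n * l ^ 2 / 2 +
        l * √(n * Module.finrank ℝ V)))) := by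
  have h1 := lintegral_pi_iSup_exp_le (ν := sphereUniform V) (γ := stdGaussian V)
    (φ := fun u a => -(l * meanNorm V * |⟪x u, a⟫|)) (ψ := fun u h => l * ⟪x u, h⟫)
    (fun u => by fun_prop) (fun u => by fun_prop)
    (fun w => by simpa only [sub_eq_add_neg] using lintegral_sphereUniform_iSup_le hl w hx)
    n (fun _ => 0)
  simp only [zero_add] at h1
  refine h1.trans ?_
  rw [← ENNReal.ofReal_pow (Real.exp_pos _).le, ← Real.exp_nat_mul, Real.exp_add,
    ENNReal.ofReal_mul (Real.exp_pos _).le, mul_neg]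
  gcongr
  have hnp : (0 : ℝ) < n := by exact_mod_cast hn
  refine le_trans ?_ (lintegral_exp_norm_le_of_subgaussian
    (μ := Measure.pi (fun _ : Fin n => stdGaussian V)) (X := fun h => ∑ j, h j) (by fun_prop) hnp
    (fun w => ?_) hl)
  · refine lintegral_mono fun h => iSup_le fun u => ?_
    rw [← Finset.mul_sum, ← inner_sum]
    gcongr
    simpa [hx] using real_inner_le_norm (x u) (∑ j, h j)
  · simp_rw [inner_sum]
    rw [mul_div_assoc]
    exact lintegral_pi_exp_sum_le (by fun_prop) (lintegral_exp_inner_stdGaussian w).le n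

/-- The permeance lower bound for a finite set of directions. -/
lemma measure_exists_sum_abs_inner_lt_le_of_finite [Nontrivial V] (hd : 2 ≤ Module.finrank ℝ V)
    {ι : Type*} [Fintype ι] {x : ι → V} (hx : ∀ u, ‖x u‖ = 1) {n : ℕ} (hn : 0 < n)
    {y : ℝ} (hy : 0 < y) :
    Measure.pi (fun _ : Fin n => sphereUniform V) {a | ∃ u, ∑ j, |⟪x u, a j⟫| <
      √(2 / Real.pi) * (n / √(Module.finrank ℝ V)) - 2 * √n -
        √(2 * n * y / ((Module.finrank ℝ V : ℝ) - 1))} ≤ ENNReal.ofReal (Real.exp (-y)) := by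
  have hdR : (2 : ℝ) ≤ Module.finrank ℝ V := by exact_mod_cast hd
  have hnp : (0 : ℝ) < n := by exact_mod_cast hn
  set d : ℝ := (Module.finrank ℝ V : ℝ) with hdd
  have hd1 : 0 < d - 1 := by linarith
  set m := √(2 / Real.pi) with hm
  set t := √(2 * n * y / (d - 1)) with ht
  have ht2 : t ^ 2 = 2 * n * y / (d - 1) := Real.sq_sqrt (by positivity)
  have htp : 0 < t := Real.sqrt_pos.2 (by positivity)
  set ρ := meanNorm V with hρ
  have hρp : 0 < ρ := meanNorm_pos
  have hρ1 : d - 1 ≤ ρ ^ 2 := finrank_sub_one_le_meanNorm_sq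
  have hρ2 : ρ ^ 2 ≤ d := meanNorm_sq_le
  have hρd : ρ ≤ √d := Real.le_sqrt_of_sq_le hρ2
  -- As d ≥ 2, 4ρ² ≥ 4(d - 1) ≥ d. This is where the 2 in 2√n comes from.
  have hdρ : √d ≤ 2 * ρ := by
    rw [Real.sqrt_le_left (by positivity)]; nlinarith
  have hsd : 0 < √d := Real.sqrt_pos.2 (by linarith)
  set L := m * (n / √d) - 2 * √n - t with hL
  -- With this Chernoff parameter lρt = 2y and nl²/2 ≤ y, so the exponent is at most -y.
  set l := t * (d - 1) / (n * ρ) with hl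
  have hlp : 0 < l := by positivity
  have h1 := lintegral_pi_sphereUniform_iSup_le hlp hx hn
  set Z : (Fin n → V) → ENNReal := fun a =>
    ⨆ u, ENNReal.ofReal (Real.exp (∑ j, -(l * ρ * |⟪x u, a j⟫|))) with hZ
  have hsub : {a : Fin n → V | ∃ u, ∑ j, |⟪x u, a j⟫| < L} ⊆
      {a | ENNReal.ofReal (Real.exp (-(l * ρ * L))) ≤ Z a} := by
    rintro a ⟨u, hu⟩
    refine le_trans (ENNReal.ofReal_le_ofReal (Real.exp_le_exp.2 ?_))
      (le_iSup (fun u => ENNReal.ofReal (Real.exp (∑ j, -(l * ρ * |⟪x u, a j⟫|)))) u)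
    rw [Finset.sum_neg_distrib, ← Finset.mul_sum, neg_le_neg_iff]
    gcongr
  have h2 := mul_meas_ge_le_lintegral (μ := Measure.pi (fun _ : Fin n => sphereUniform V))
    (f := Z) (by fun_prop) (ENNReal.ofReal (Real.exp (-(l * ρ * L))))
  have h3 := h2.trans h1
  have e1 : ENNReal.ofReal (Real.exp (l * ρ * L)) * ENNReal.ofReal (Real.exp (-(l * ρ * L))) = 1 := by
    rw [← ENNReal.ofReal_mul (Real.exp_pos _).le, ← Real.exp_add]; simp
  calc _ ≤ Measure.pi (fun _ : Fin n => sphereUniform V)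
        {a | ENNReal.ofReal (Real.exp (-(l * ρ * L))) ≤ Z a} := measure_mono hsub
    _ = ENNReal.ofReal (Real.exp (l * ρ * L)) * (ENNReal.ofReal (Real.exp (-(l * ρ * L))) *
        Measure.pi (fun _ : Fin n => sphereUniform V)
        {a | ENNReal.ofReal (Real.exp (-(l * ρ * L))) ≤ Z a}) := by
        rw [← mul_assoc, e1, one_mul]
    _ ≤ ENNReal.ofReal (Real.exp (l * ρ * L)) * ENNReal.ofReal (Real.exp (-(n * (l * m)) +
        (n * l ^ 2 / 2 + l * √(n * d)))) := by gcongr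
    _ ≤ _ := by
        rw [← ENNReal.ofReal_mul (Real.exp_pos _).le, ← Real.exp_add]
        refine ENNReal.ofReal_le_ofReal (Real.exp_le_exp.2 ?_)
        have a1 : l * ρ * (m * (n / √d)) ≤ n * (l * m) := by
          have : ρ / √d ≤ 1 := (div_le_one hsd).2 hρd
          calc l * ρ * (m * (n / √d)) = (n * (l * m)) * (ρ / √d) := by ring
            _ ≤ (n * (l * m)) * 1 := by gcongr
            _ = _ := mul_one _
        have a2 : l * √(n * d) ≤ l * ρ * (2 * √n) := by
          rw [Real.sqrt_mul hnp.le]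
          calc l * (√n * √d) ≤ l * (√n * (2 * ρ)) := by gcongr
            _ = _ := by ring
        have a3 : l * ρ * t = 2 * y := by
          have : l * ρ * t = t ^ 2 * (d - 1) / n := by rw [hl]; field_simp
          rw [this, ht2]; field_simp
        have a4 : n * l ^ 2 / 2 ≤ y := by
          have : n * l ^ 2 / 2 = y * ((d - 1) / ρ ^ 2) := by
            have : n * l ^ 2 / 2 = t ^ 2 * (d - 1) ^ 2 / (2 * n * ρ ^ 2) := by
              rw [hl]; field_simp
            rw [this, ht2]; field_simp
          rw [this]
          exact mul_le_of_le_one_right hy.le ((div_le_one (by positivity)).2 hρ1)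
        rw [hL]
        linarith

/-- The permeance lower bound for uniformly distributed points of the sphere. -/
lemma measure_exists_sum_abs_inner_lt_le [Nontrivial V] (hd : 2 ≤ Module.finrank ℝ V) (n : ℕ)
    {y : ℝ} (hy : 0 < y) :
    Measure.pi (fun _ : Fin n => sphereUniform V) {a | ∃ x : V, ‖x‖ = 1 ∧ ∑ j, |⟪x, a j⟫| <
      √(2 / Real.pi) * (n / √(Module.finrank ℝ V)) - 2 * √n -
        √(2 * n * y / ((Module.finrank ℝ V : ℝ) - 1))} ≤ ENNReal.ofReal (Real.exp (-y)) := by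
  rcases Nat.eq_zero_or_pos n with rfl | hn
  · simp
  set L := √(2 / Real.pi) * (n / √(Module.finrank ℝ V)) - 2 * √n -
        √(2 * n * y / ((Module.finrank ℝ V : ℝ) - 1)) with hL
  have hne : Nonempty (Metric.sphere (0 : V) 1) :=
    (NormedSpace.sphere_nonempty.2 zero_le_one).to_subtype
  let x := TopologicalSpace.denseSeq (Metric.sphere (0 : V) 1)
  -- The strict inequality is open in the direction, so a violation occurs at some member of a dense
  -- sequence; the finite bound is uniform in N and passes to the increasing union.
  let S : ℕ → Set (Fin n → V) := fun N => {a | ∃ i : Fin N, ∑ j, |⟪(x i : V), a j⟫| < L}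
  have hS : Monotone S := by
    rintro N N' hN a ⟨i, hi⟩
    exact ⟨⟨i, i.2.trans_le hN⟩, hi⟩
  have hsub : {a : Fin n → V | ∃ x : V, ‖x‖ = 1 ∧ ∑ j, |⟪x, a j⟫| < L} ⊆ ⋃ N, S N := by
    rintro a ⟨z, hz, hza⟩
    have hc : Continuous fun z : Metric.sphere (0 : V) 1 => ∑ j, |⟪(z : V), a j⟫| := by fun_prop
    obtain ⟨i, hi⟩ := (TopologicalSpace.denseRange_denseSeq (Metric.sphere (0 : V) 1)).exists_mem_open
      (hc.isOpen_preimage _ isOpen_Iio) ⟨⟨z, by simpa using hz⟩, hza⟩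
    exact Set.mem_iUnion.2 ⟨i + 1, ⟨i, Nat.lt_succ_self i⟩, hi⟩
  refine (measure_mono hsub).trans ?_
  rw [hS.measure_iUnion]
  refine iSup_le fun N => ?_
  exact measure_exists_sum_abs_inner_lt_le_of_finite hd (x := fun i : Fin N => (x i : V))
    (fun i => by simp) hn hy

end Permeance

/-! ### Tail bounds for sums of uniform directions -/

section UniformSums

variable {V : Type*} [NormedAddCommGroup V] [InnerProductSpace ℝ V] [FiniteDimensional ℝ V]
  [MeasurableSpace V] [BorelSpace V]

lemma measure_lt_le_of_lintegral_exp_le {T : Type*} [MeasurableSpace T] {μ : Measure T} {f : T → ℝ}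
    (hf : Measurable f) {x c : ℝ}
    (h : ∫⁻ t, ENNReal.ofReal (Real.exp (f t)) ∂μ ≤ ENNReal.ofReal (Real.exp c)) :
    μ {t | x < f t} ≤ ENNReal.ofReal (Real.exp (c - x)) := by
  have h1 := (mul_meas_ge_le_lintegral (μ := μ) (f := fun t => ENNReal.ofReal (Real.exp (f t)))
    (by fun_prop) (ENNReal.ofReal (Real.exp x))).trans h
  have h2 : {t | x < f t} ⊆ {t | ENNReal.ofReal (Real.exp x) ≤ ENNReal.ofReal (Real.exp (f t))} :=
    fun t ht => ENNReal.ofReal_le_ofReal (Real.exp_le_exp.2 (le_of_lt ht))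
  have e1 : ENNReal.ofReal (Real.exp (-x)) * ENNReal.ofReal (Real.exp x) = 1 := by
    rw [← ENNReal.ofReal_mul (Real.exp_pos _).le, ← Real.exp_add]; simp
  calc μ {t | x < f t}
      ≤ μ {t | ENNReal.ofReal (Real.exp x) ≤ ENNReal.ofReal (Real.exp (f t))} := measure_mono h2
    _ = ENNReal.ofReal (Real.exp (-x)) * (ENNReal.ofReal (Real.exp x) *
        μ {t | ENNReal.ofReal (Real.exp x) ≤ ENNReal.ofReal (Real.exp (f t))}) := by
        rw [← mul_assoc, e1, one_mul]
    _ ≤ ENNReal.ofReal (Real.exp (-x)) * ENNReal.ofReal (Real.exp c) := by gcongr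
    _ = _ := by
        rw [← ENNReal.ofReal_mul (Real.exp_pos _).le, ← Real.exp_add]
        congr 2
        ring

lemma lintegral_pi_sphereUniform_exp_inner_le [Nontrivial V] (hd : 2 ≤ Module.finrank ℝ V) (n : ℕ)
    (w : V) :
    ∫⁻ v, ENNReal.ofReal (Real.exp ⟪w, ∑ j, v j⟫)
        ∂Measure.pi (fun _ : Fin n => sphereUniform V) ≤
      ENNReal.ofReal (Real.exp (n / ((Module.finrank ℝ V : ℝ) - 1) * ‖w‖ ^ 2 / 2)) := by
  simp_rw [inner_sum]
  refine (lintegral_pi_exp_sum_le (by fun_prop) (lintegral_exp_inner_sphereUniform_le hd w) n).trans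
    (Eq.le ?_)
  have hdR : (2 : ℝ) ≤ Module.finrank ℝ V := by exact_mod_cast hd
  have : (Module.finrank ℝ V : ℝ) - 1 ≠ 0 := by linarith
  congr 2
  field_simp

/-- The projection onto a subspace of a sum of independent uniform directions. -/
lemma measure_norm_starProjection_sum_gt_le [Nontrivial V] (hd : 3 ≤ Module.finrank ℝ V)
    (U : Submodule ℝ V) (hU : 1 ≤ Module.finrank ℝ U) {n : ℕ} (hn : 0 < n) {y : ℝ} (hy : 1 ≤ y) :
    Measure.pi (fun _ : Fin n => sphereUniform V) {v |
      3 * √(n * Module.finrank ℝ U * y / Module.finrank ℝ V) < ‖U.starProjection (∑ j, v j)‖} ≤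
      ENNReal.ofReal (Real.exp (-y)) := by
  have hdR : (3 : ℝ) ≤ Module.finrank ℝ V := by exact_mod_cast hd
  have hrR : (1 : ℝ) ≤ Module.finrank ℝ U := by exact_mod_cast hU
  have hnp : (0 : ℝ) < n := by exact_mod_cast hn
  set d : ℝ := (Module.finrank ℝ V : ℝ) with hdd
  set r : ℝ := (Module.finrank ℝ U : ℝ) with hrr
  have hd1 : 0 < d - 1 := by linarith
  set s : ℝ := n / (d - 1) with hs
  have hsp : 0 < s := by positivity
  -- Choosing b = 1/2 gives a moment at most 2^{r/2} ≤ e^{r/2}.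
  have h1 := lintegral_exp_sq_norm_le_of_subgaussian (V := U)
    (μ := Measure.pi (fun _ : Fin n => sphereUniform V))
    (X := fun v => U.orthogonalProjectionOnto (∑ j, v j)) (by fun_prop) hsp (fun w => by
      refine le_trans (Eq.le (lintegral_congr fun v => ?_))
        (lintegral_pi_sphereUniform_exp_inner_le (by omega) n (w : V))
      rw [Submodule.inner_orthogonalProjectionOnto_eq_of_mem_left]) (b := 1 / 2)
    (by norm_num) (by norm_num)
  have h2 : (1 - 1 / 2 : ℝ) ^ (-r / 2) ≤ Real.exp (r / 2) := by
    rw [show (1 - 1 / 2 : ℝ) = 2⁻¹ by norm_num, Real.inv_rpow (by norm_num),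
      ← Real.rpow_neg (by norm_num), neg_div, neg_neg]
    calc (2 : ℝ) ^ (r / 2) ≤ (Real.exp 1) ^ (r / 2) :=
          Real.rpow_le_rpow (by norm_num) (by linarith [Real.add_one_le_exp 1]) (by positivity)
      _ = _ := by rw [← Real.exp_mul, one_mul]
  have h3 := measure_lt_le_of_lintegral_exp_le (x := 1 / 2 / (2 * s) * (9 * (n * r * y / d)))
    (by fun_prop) (h1.trans (ENNReal.ofReal_le_ofReal h2))
  refine (measure_mono fun v hv => ?_).trans (h3.trans (ENNReal.ofReal_le_ofReal
    (Real.exp_le_exp.2 ?_)))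
  · have hv' : 3 * √(n * r * y / d) < ‖U.orthogonalProjectionOnto (∑ j, v j)‖ := by
      rw [Set.mem_ofPred_eq, Submodule.starProjection_apply] at hv
      exact hv
    simp only [Set.mem_ofPred_eq]
    have h4 := pow_lt_pow_left₀ hv' (by positivity) two_ne_zero
    rw [mul_pow, Real.sq_sqrt (by positivity)] at h4
    have : 0 < 1 / 2 / (2 * s) := by positivity
    have h5 := mul_lt_mul_of_pos_left h4 this
    norm_num at h5 ⊢
    exact h5
  · have e : 1 / 2 / (2 * s) * (9 * (n * r * y / d)) = 9 / 4 * r * y * ((d - 1) / d) := by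
      rw [hs]; field_simp; norm_num
    -- From d ≥ 3 the Chernoff exponent is at most r/2 - (3/2)ry, which is at most -y since r, y ≥
    -- 1.
    have h6 : 2 / 3 ≤ (d - 1) / d := by rw [div_le_div_iff₀ (by norm_num) (by linarith)]; linarith
    have h7 : 9 / 4 * r * y * (2 / 3) ≤ 9 / 4 * r * y * ((d - 1) / d) := by gcongr
    rw [e]
    nlinarith

/-- The sum of the coordinates of independent uniform directions along a unit vector. -/
lemma measure_sum_inner_gt_le [Nontrivial V] (hd : 2 ≤ Module.finrank ℝ V) {p : V} (hp : ‖p‖ = 1)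
    {n : ℕ} (hn : 0 < n) {y : ℝ} (hy : 0 ≤ y) :
    Measure.pi (fun _ : Fin n => sphereUniform V) {v |
      n * (3 * √(y / Module.finrank ℝ V)) < ⟪p, ∑ j, v j⟫} ≤ ENNReal.ofReal (Real.exp (-y)) := by
  have hdR : (2 : ℝ) ≤ Module.finrank ℝ V := by exact_mod_cast hd
  have hnR : (1 : ℝ) ≤ n := by exact_mod_cast hn
  rcases hy.eq_or_lt with rfl | hy
  · simp only [neg_zero, Real.exp_zero, ENNReal.ofReal_one]
    exact prob_le_one
  -- The length (d - 1)x, with x = 3√(y/d), minimises nλ²/(2(d - 1)) - λnx over λ.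
  have h1 := lintegral_pi_sphereUniform_exp_inner_le hd n
    ((((Module.finrank ℝ V : ℝ) - 1) * (3 * √(y / Module.finrank ℝ V))) • p)
  set d : ℝ := (Module.finrank ℝ V : ℝ) with hdd
  have hd1 : 0 < d - 1 := by linarith
  set x := 3 * √(y / d) with hx
  have hxp : 0 < x := by positivity
  have hx2 : x ^ 2 = 9 * (y / d) := by
    rw [hx, mul_pow, Real.sq_sqrt (by positivity)]; norm_num
  rw [norm_smul, hp, mul_one, Real.norm_of_nonneg (by positivity)] at h1
  have h2 := measure_lt_le_of_lintegral_exp_le (x := (d - 1) * x * (n * x)) (by fun_prop) h1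
  refine (measure_mono fun v hv => ?_).trans (h2.trans (ENNReal.ofReal_le_ofReal
    (Real.exp_le_exp.2 ?_)))
  · simp only [Set.mem_ofPred_eq] at hv ⊢
    rw [inner_smul_left, conj_trivial]
    gcongr
  · have e : n / (d - 1) * ((d - 1) * x) ^ 2 / 2 - (d - 1) * x * (n * x) =
        -(n * (d - 1) * x ^ 2 / 2) := by field_simp; ring
    rw [e, hx2, neg_le_neg_iff]
    have h6 : 1 / 2 ≤ (d - 1) / d := by rw [div_le_div_iff₀ (by norm_num) (by linarith)]; linarith
    calc y ≤ 1 * 9 * y / 2 * (1 / 2) := by linarith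
      _ ≤ n * 9 * y / 2 * ((d - 1) / d) := by gcongr
      _ = _ := by ring

end UniformSums

/-! ### Recovery from the ordering of the columns -/

section Recovery

variable {M ni no : ℕ} {U : Submodule ℝ (EuclideanSpace ℝ (Fin M))}
  {a : Fin ni → EuclideanSpace ℝ (Fin M)} {b : Fin no → EuclideanSpace ℝ (Fin M)}

/-- Points whose permeance is bounded below span the subspace. -/
lemma span_range_eq_of_le_sum_abs_inner (ha : ∀ i, a i ∈ U) {L : ℝ} (hL : 0 < L)
    (h : ∀ u ∈ U, L * ‖u‖ ≤ ∑ j, |⟪u, a j⟫|) : Submodule.span ℝ (Set.range a) = U := by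
  have hle : Submodule.span ℝ (Set.range a) ≤ U :=
    Submodule.span_le.2 (Set.range_subset_iff.2 ha)
  refine le_antisymm hle fun u hu => ?_
  set S := Submodule.span ℝ (Set.range a)
  -- The part of u orthogonal to the points has zero permeance, hence vanishes.
  have h1 : u - S.starProjection u ∈ U :=
    U.sub_mem hu (hle (Submodule.starProjection_apply_mem S u))
  have h2 : ∑ j, |⟪u - S.starProjection u, a j⟫| = 0 := by
    refine Finset.sum_eq_zero fun j _ => ?_
    rw [Submodule.starProjection_inner_eq_zero u (a j) (Submodule.subset_span (Set.mem_range_self j)),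
      abs_zero]
  have h3 := h _ h1
  rw [h2] at h3
  have h4 : ‖u - S.starProjection u‖ = 0 := le_antisymm (by nlinarith) (norm_nonneg _)
  rw [norm_eq_zero, sub_eq_zero] at h4
  rw [h4]
  exact Submodule.starProjection_apply_mem S u

/-- Sorting by a value that is smaller on the inliers than on the outliers recovers `U`. -/
lemma recoversExactly_of_lt (hno : 1 ≤ no) (hab : Submodule.span ℝ (Set.range a) = U)
    (hb : ∀ j, b j ∉ U) {x : Fin no ⊕ Fin ni → ℝ} (hx : ∀ i j, x (Sum.inr i) < x (Sum.inl j)) :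
    RecoversExactly (dataMatrix b a) x (Module.finrank ℝ U) U := by
  have ha : ∀ i, a i ∈ U := fun i => hab ▸ Submodule.subset_span ⟨i, rfl⟩
  intro σ hσ
  have hpos : ∀ i j, σ.symm (Sum.inr i) < σ.symm (Sum.inl j) := by
    intro i j
    by_contra hc
    have := hσ (not_lt.1 hc)
    simp only [Equiv.apply_symm_apply] at this
    exact absurd (hx i j) (not_lt.2 this)
  have hge : ∀ k : ℕ, (∀ i, (σ.symm (Sum.inr i) : ℕ) < k) →
      U ≤ spanOfFirst (dataMatrix b a) σ k := by
    intro k hk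
    rw [← hab]
    refine Submodule.span_mono ?_
    rintro _ ⟨i, rfl⟩
    exact ⟨σ.symm (Sum.inr i), hk i, by simp [dataMatrix]⟩
  have hle : ∀ k : ℕ, (∀ j, k ≤ (σ.symm (Sum.inl j) : ℕ)) →
      spanOfFirst (dataMatrix b a) σ k ≤ U := by
    intro k hk
    refine Submodule.span_le.2 ?_
    rintro _ ⟨m, hm, rfl⟩
    rcases hs : σ m with j | i
    · have h1 := hk j
      rw [← hs, Equiv.symm_apply_apply] at h1
      omega
    · exact ha i
  refine ⟨?_, fun k hk => ?_⟩
  · have : Nonempty (Fin no) := ⟨⟨0, hno⟩⟩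
    obtain ⟨j, hj⟩ := Finite.exists_min fun j : Fin no => (σ.symm (Sum.inl j) : ℕ)
    refine ⟨(σ.symm (Sum.inl j) : ℕ), ?_⟩
    rw [le_antisymm (hle _ hj) (hge _ fun i => hpos i j)]
  -- A segment without outliers spans a subspace of U. One with an outlier contains every inlier, so
  -- its span strictly contains U and has too large a dimension.
  · by_cases hc : ∀ j, k ≤ (σ.symm (Sum.inl j) : ℕ)
    · exact Submodule.eq_of_le_of_finrank_eq (hle k hc) hk
    · push Not at hc
      obtain ⟨j, hj⟩ := hc
      have h1 := hge k fun i => lt_trans (show (σ.symm (Sum.inr i) : ℕ) < σ.symm (Sum.inl j) from hpos i j) hj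
      have h2 : b j ∈ spanOfFirst (dataMatrix b a) σ k :=
        Submodule.subset_span ⟨σ.symm (Sum.inl j), hj, by simp [dataMatrix]⟩
      have h3 : U < spanOfFirst (dataMatrix b a) σ k :=
        lt_of_le_of_ne h1 fun he => hb j (he ▸ h2)
      have := Submodule.finrank_lt_finrank_of_lt h3
      omega

end Recovery

/-! ### The direction search problems -/

section Optimality

variable {M ni no : ℕ} {U Q : Submodule ℝ (EuclideanSpace ℝ (Fin M))}
  {p : EuclideanSpace ℝ (Fin M)}
  {a : Fin ni → EuclideanSpace ℝ (Fin M)} {b : Fin no → EuclideanSpace ℝ (Fin M)}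

lemma cost_dataMatrix (c : EuclideanSpace ℝ (Fin M)) :
    cost (dataMatrix b a) c = ∑ i, |⟪c, b i⟫| + ∑ j, |⟪c, a j⟫| := by
  simp [cost, dataMatrix, Fintype.sum_sum_type]

lemma continuous_cost {ι : Type*} [Fintype ι] (D : ι → EuclideanSpace ℝ (Fin M)) :
    Continuous (cost D) := by
  unfold cost
  fun_prop

lemma cost_add_smul (hpU : ∀ u ∈ U, ⟪p, u⟫ = 0) (ha : ∀ i, a i ∈ U)
    (u : EuclideanSpace ℝ (Fin M)) (t : ℝ) :
    cost (dataMatrix b a) (u + t • p) =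
      ∑ i, |⟪u, b i⟫ + t * ⟪p, b i⟫| + ∑ j, |⟪u, a j⟫| := by
  rw [cost_dataMatrix]
  congr 1
  · simp only [inner_add_left, inner_smul_left, conj_trivial]
  · refine Finset.sum_congr rfl fun j _ => ?_
    rw [inner_add_left, inner_smul_left, hpU _ (ha j), mul_zero, add_zero]

lemma abs_inner_le_norm_mul_norm_starProjection {u : EuclideanSpace ℝ (Fin M)} (hu : u ∈ U)
    (x : EuclideanSpace ℝ (Fin M)) : |⟪u, x⟫| ≤ ‖u‖ * ‖U.starProjection x‖ := by
  have : ⟪u, x⟫ = ⟪u, U.starProjection x⟫ := by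
    rw [← Submodule.inner_starProjection_left_eq_right, Submodule.starProjection_eq_self_iff.2 hu]
  rw [this]
  exact abs_real_inner_le_norm _ _

/-- The cost grows away from the direction `p` on the feasible set of an outlier. -/
lemma cost_outlier_add_le (hpU : ∀ u ∈ U, ⟪p, u⟫ = 0) (ha : ∀ i, a i ∈ U) {s : ℝ}
    (hsb : ∀ i, 0 < s * ⟪p, b i⟫) {L β : ℝ} (hL : ∀ u ∈ U, L * ‖u‖ ≤ ∑ j, |⟪u, a j⟫|)
    (hβ : ∀ i, 1 / |⟪p, b i⟫| ≤ β) (k : Fin no) {u : EuclideanSpace ℝ (Fin M)} (hu : u ∈ U) {t : ℝ}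
    (hk : ⟪u, b k⟫ + t * ⟪p, b k⟫ = 1) :
    (∑ i, |⟪p, b i⟫|) / |⟪p, b k⟫| + ‖u‖ * (L - ‖U.starProjection (∑ i, b i)‖ -
      ‖U.starProjection (b k)‖ * (β * ∑ i, |⟪p, b i⟫|)) ≤
      cost (dataMatrix b a) (u + t • p) := by
  have hxk : ⟪p, b k⟫ ≠ 0 := fun h => by simpa [h] using hsb k
  have hs0 : s ≠ 0 := fun h => by simpa [h] using hsb k
  -- The outliers lie on one side of U, so absolute values differ from signed values by a common
  -- sign.
  have habs : ∀ i, |⟪p, b i⟫| = ⟪p, b i⟫ * (|s| / s) := by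
    intro i
    rw [← mul_div_assoc, eq_div_iff hs0]
    rcases lt_or_gt_of_ne hs0 with h | h
    · have h1 : ⟪p, b i⟫ < 0 := by by_contra hc; nlinarith [hsb i]
      rw [abs_of_neg h, abs_of_neg h1]; ring
    · have h1 : 0 < ⟪p, b i⟫ := by by_contra hc; nlinarith [hsb i]
      rw [abs_of_pos h, abs_of_pos h1]
  have hss : |s| / s ≠ 0 := div_ne_zero (abs_ne_zero.2 hs0) hs0
  have hratio : (∑ i, |⟪p, b i⟫|) / |⟪p, b k⟫| = (∑ i, ⟪p, b i⟫) / ⟪p, b k⟫ := by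
    simp_rw [habs]
    rw [← Finset.sum_mul, mul_div_mul_right _ _ hss]
  set S := ∑ i, |⟪p, b i⟫| with hS
  have hS0 : 0 ≤ S := Finset.sum_nonneg fun _ _ => abs_nonneg _
  rw [cost_add_smul hpU ha]
  -- Dropping the absolute values loses nothing at u = 0 if t has the common sign of the ⟪p, b i⟫,
  -- as the constraint then forces.
  have h1 : ⟪u, ∑ i, b i⟫ + t * ∑ i, ⟪p, b i⟫ ≤ ∑ i, |⟪u, b i⟫ + t * ⟪p, b i⟫| := by
    rw [inner_sum, Finset.mul_sum, ← Finset.sum_add_distrib]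
    exact Finset.sum_le_sum fun i _ => le_abs_self _
  have h2 : t * ∑ i, ⟪p, b i⟫ = S / |⟪p, b k⟫| - ⟪u, b k⟫ * (S / |⟪p, b k⟫|) := by
    have : t = (1 - ⟪u, b k⟫) / ⟪p, b k⟫ := by rw [eq_div_iff hxk]; linarith
    rw [hratio, this]; ring
  have h3 := abs_inner_le_norm_mul_norm_starProjection hu (∑ i, b i)
  have h4 : |⟪u, b k⟫ * (S / |⟪p, b k⟫|)| ≤ ‖u‖ * (‖U.starProjection (b k)‖ * (β * S)) := by
    rw [abs_mul, abs_of_nonneg (a := S / _) (by positivity), ← mul_assoc]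
    refine mul_le_mul (abs_inner_le_norm_mul_norm_starProjection hu (b k)) ?_ (by positivity)
      (by positivity)
    have := mul_le_mul_of_nonneg_right (hβ k) hS0
    rwa [one_div_mul_eq_div] at this
  have h5 := hL u hu
  have h6 := neg_abs_le ⟪u, ∑ i, b i⟫
  have h7 := le_abs_self (⟪u, b k⟫ * (S / |⟪p, b k⟫|))
  nlinarith

/-- By Pythagoras the two terms have squares summing to at most 2. The bound lets the two conditions
on L be combined although outliers need not be unit vectors. -/
lemma norm_starProjection_add_abs_inner_le_two (hp : ‖p‖ = 1) (hpU : ∀ u ∈ U, ⟪p, u⟫ = 0)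
    {x : EuclideanSpace ℝ (Fin M)} (hx : ‖x‖ ^ 2 ≤ 2) :
    ‖U.starProjection x‖ + |⟪p, x⟫| ≤ 2 := by
  set y := U.starProjection x with hy
  have h1 : ‖x‖ ^ 2 = ‖y‖ ^ 2 + ‖x - y‖ ^ 2 := by
    have h2 : ⟪y, x - y⟫ = 0 := by
      rw [real_inner_comm]
      exact Submodule.starProjection_inner_eq_zero x y (Submodule.starProjection_apply_mem U x)
    have h3 := norm_add_sq_real y (x - y)
    rw [add_sub_cancel, h2] at h3
    linarith
  have h4 : |⟪p, x⟫| ≤ ‖x - y‖ := by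
    have : ⟪p, x⟫ = ⟪p, x - y⟫ := by
      rw [inner_sub_right, hpU _ (Submodule.starProjection_apply_mem U x), sub_zero]
    rw [this]
    simpa [hp] using abs_real_inner_le_norm p (x - y)
  nlinarith [norm_nonneg y, norm_nonneg (x - y), sq_nonneg (‖y‖ - ‖x - y‖),
    sq_nonneg (‖y‖ + ‖x - y‖ - 2)]

/-- The deterministic part: permeance of the inliers dominating the outliers guarantees exact
recovery. -/
theorem recovery_of_permeance (hno : 1 ≤ no) (hp : ‖p‖ = 1) (hpU : ∀ u ∈ U, ⟪p, u⟫ = 0)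
    (hQ : ∀ c, c ∈ Q ↔ ∃ u ∈ U, ∃ t : ℝ, c = u + t • p) (ha : ∀ i, a i ∈ U)
    (ha1 : ∀ i, ‖a i‖ = 1) {s : ℝ} (hsb : ∀ i, 0 < s * ⟪p, b i⟫) (hb2 : ∀ i, ‖b i‖ ^ 2 ≤ 2)
    {L β : ℝ} (hL : ∀ u ∈ U, L * ‖u‖ ≤ ∑ j, |⟪u, a j⟫|) (hβ : ∀ i, 1 / |⟪p, b i⟫| ≤ β)
    (h1 : 2 * β * ‖U.starProjection (∑ i, b i)‖ < L) (h2 : 2 * β * ∑ i, |⟪p, b i⟫| < L) :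
    (∀ k, ∃ c, IsOptimalDirection (dataMatrix b a) Q (dataMatrix b a k) c) ∧
    (∀ j c, IsOptimalDirection (dataMatrix b a) Q (b j) c ↔ c = (1 / ⟪b j, p⟫) • p) ∧
    ∀ c : Fin no ⊕ Fin ni → EuclideanSpace ℝ (Fin M),
      (∀ k, IsOptimalDirection (dataMatrix b a) Q (dataMatrix b a k) (c k)) →
      (∀ i j, innovationValue (dataMatrix b a) (c (Sum.inr i)) <
        innovationValue (dataMatrix b a) (c (Sum.inl j))) ∧
      RecoversExactly (dataMatrix b a) (fun k => innovationValue (dataMatrix b a) (c k))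
        (Module.finrank ℝ U) U := by
  have hx0 : ∀ i, ⟪p, b i⟫ ≠ 0 := fun i h => by simpa [h] using hsb i
  have hxp : ∀ i, 0 < |⟪p, b i⟫| := fun i => abs_pos.2 (hx0 i)
  let k0 : Fin no := ⟨0, hno⟩
  have hβp : 0 < β := lt_of_lt_of_le (by have := hxp k0; positivity) (hβ k0)
  set S := ∑ i, |⟪p, b i⟫| with hS
  have hS0 : 0 ≤ S := Finset.sum_nonneg fun _ _ => abs_nonneg _
  have hLp : 0 < L := lt_of_le_of_lt (by positivity) h2
  have hpp : ⟪p, p⟫ = 1 := by rw [real_inner_self_eq_norm_sq, hp, one_pow]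
  -- the rate at which the cost of an outlier direction grows
  have hκ : ∀ k, 0 < L - ‖U.starProjection (∑ i, b i)‖ -
      ‖U.starProjection (b k)‖ * (β * S) := by
    intro k
    have h3 := norm_starProjection_add_abs_inner_le_two hp hpU (hb2 k)
    have h4 : 1 ≤ β * |⟪p, b k⟫| := (div_le_iff₀ (hxp k)).1 (hβ k)
    have h5 : ‖U.starProjection (b k)‖ * (β * S) ≤ ‖U.starProjection (b k)‖ * (L / 2) := by
      gcongr; linarith
    have h6 : 1 ≤ β * (2 - ‖U.starProjection (b k)‖) :=
      h4.trans (by gcongr; linarith)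
    -- The left factor equals (L/2) β(2 - ‖P b_k‖) - β‖P Σ b_i‖, at least L/2 - β‖P Σ b_i‖ > 0.
    have h7 : 0 < β * (L - ‖U.starProjection (∑ i, b i)‖ -
      ‖U.starProjection (b k)‖ * (L / 2)) := by nlinarith
    have h8 := (mul_pos_iff_of_pos_left hβp).1 h7
    linarith
  have hmem : ∀ j, (1 / ⟪b j, p⟫) • p ∈ feasible Q (b j) := by
    intro j
    refine ⟨?_, (hQ _).2 ⟨0, U.zero_mem, _, (zero_add _).symm⟩⟩
    rw [inner_smul_left, real_inner_comm, conj_trivial, one_div_mul_cancel (hx0 j)]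
  have hcost0 : ∀ j, cost (dataMatrix b a) ((1 / ⟪b j, p⟫) • p) = S / |⟪p, b j⟫| := by
    intro j
    have h := cost_add_smul (b := b) hpU ha 0 (1 / ⟪b j, p⟫)
    rw [zero_add] at h
    rw [h, real_inner_comm]
    simp only [inner_zero_left, zero_add, abs_zero, Finset.sum_const_zero, add_zero, abs_mul]
    rw [← Finset.mul_sum, abs_div, abs_one, one_div_mul_eq_div]
  have hout : ∀ j c, IsOptimalDirection (dataMatrix b a) Q (b j) c ↔
      c = (1 / ⟪b j, p⟫) • p := by
    have hlow : ∀ j, ∀ c ∈ feasible Q (b j), ∃ u : EuclideanSpace ℝ (Fin M), ∃ t : ℝ,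
        c = u + t • p ∧ ⟪u, b j⟫ + t * ⟪p, b j⟫ = 1 ∧
        cost (dataMatrix b a) ((1 / ⟪b j, p⟫) • p) + ‖u‖ *
          (L - ‖U.starProjection (∑ i, b i)‖ - ‖U.starProjection (b j)‖ * (β * S)) ≤
        cost (dataMatrix b a) c := by
      rintro j c ⟨hc1, hcQ⟩
      obtain ⟨u, hu, t, rfl⟩ := (hQ c).1 hcQ
      have hk : ⟪u, b j⟫ + t * ⟪p, b j⟫ = 1 := by
        rwa [inner_add_left, inner_smul_left, conj_trivial] at hc1
      refine ⟨u, t, rfl, hk, ?_⟩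
      rw [hcost0]
      exact cost_outlier_add_le hpU ha hsb hL hβ j hu hk
    intro j c
    constructor
    · rintro ⟨hc, hmin⟩
      obtain ⟨u, t, rfl, hk, h3⟩ := hlow j c hc
      have h4 := isMinOn_iff.1 hmin _ (hmem j)
      have h5 : ‖u‖ = 0 := le_antisymm
        (by by_contra hne; nlinarith [mul_pos (not_le.1 hne) (hκ j)]) (norm_nonneg _)
      rw [norm_eq_zero] at h5
      subst h5
      rw [inner_zero_left, zero_add] at hk
      rw [zero_add, real_inner_comm, eq_div_of_mul_eq (hx0 j) hk]
    · rintro rfl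
      refine ⟨hmem j, isMinOn_iff.2 fun c hc => ?_⟩
      obtain ⟨u, t, -, -, h3⟩ := hlow j c hc
      have := mul_nonneg (norm_nonneg u) (hκ j).le
      linarith
  -- The constraint reads ⟪u, a i⟫ = 1, which forces ‖u‖ ≥ 1.
  have hinl : ∀ i, ∀ c ∈ feasible Q (a i), L ≤ cost (dataMatrix b a) c := by
    rintro i c ⟨hc1, hcQ⟩
    obtain ⟨u, hu, t, rfl⟩ := (hQ c).1 hcQ
    rw [inner_add_left, inner_smul_left, hpU _ (ha i), mul_zero, add_zero] at hc1
    have h3 := real_inner_le_norm u (a i)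
    rw [hc1, ha1, mul_one] at h3
    rw [cost_add_smul hpU ha]
    have h4 : 0 ≤ ∑ i, |⟪u, b i⟫ + t * ⟪p, b i⟫| := Finset.sum_nonneg fun _ _ => abs_nonneg _
    nlinarith [hL u hu]
  have hbU : ∀ j, b j ∉ U := fun j hj => hx0 j (hpU _ hj)
  refine ⟨?_, hout, fun c hc => ?_⟩
  · rintro (j | i)
    · exact ⟨_, (hout j _).2 rfl⟩
    · change ∃ c, IsOptimalDirection (dataMatrix b a) Q (a i) c
      set C := cost (dataMatrix b a) (a i) with hC
      have hai : a i ∈ feasible Q (a i) :=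
        ⟨by rw [real_inner_self_eq_norm_sq, ha1, one_pow], (hQ _).2 ⟨a i, ha i, 0, by simp⟩⟩
      -- A sublevel set of the cost is compact: permeance bounds u, and then a single outlier bounds
      -- t.
      let K : Set (EuclideanSpace ℝ (Fin M)) :=
        feasible Q (a i) ∩ {c | cost (dataMatrix b a) c ≤ C}
      have hKc : IsClosed K := by
        refine IsClosed.inter (IsClosed.inter (isClosed_eq (by fun_prop) continuous_const)
          Q.closed_of_finiteDimensional) (isClosed_le (continuous_cost _) continuous_const)
      have hKb : Bornology.IsBounded K := by
        refine (Metric.isBounded_closedBall (x := (0 : EuclideanSpace ℝ (Fin M)))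
          (r := C / L + (C + C / L * ‖b k0‖) / |⟪p, b k0⟫|)).subset ?_
        rintro c ⟨⟨-, hcQ⟩, hcC⟩
        obtain ⟨u, hu, t, rfl⟩ := (hQ c).1 hcQ
        rw [mem_closedBall_zero_iff]
        have h3 : cost (dataMatrix b a) (u + t • p) ≤ C := hcC
        rw [cost_add_smul hpU ha] at h3
        have h4 := hL u hu
        have h5 : |⟪u, b k0⟫ + t * ⟪p, b k0⟫| ≤ ∑ i, |⟪u, b i⟫ + t * ⟪p, b i⟫| :=
          Finset.single_le_sum (f := fun i => |⟪u, b i⟫ + t * ⟪p, b i⟫|)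
            (fun _ _ => abs_nonneg _) (Finset.mem_univ k0)
        have h6 : 0 ≤ ∑ j, |⟪u, a j⟫| := Finset.sum_nonneg fun _ _ => abs_nonneg _
        have h7 : ‖u‖ ≤ C / L := by
          rw [le_div_iff₀ hLp]
          linarith [abs_nonneg (⟪u, b k0⟫ + t * ⟪p, b k0⟫)]
        have h8 : |t| ≤ (C + C / L * ‖b k0‖) / |⟪p, b k0⟫| := by
          rw [le_div_iff₀ (hxp k0), ← abs_mul]
          have h9 : |⟪u, b k0⟫| ≤ C / L * ‖b k0‖ :=
            (abs_real_inner_le_norm _ _).trans (by gcongr)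
          have h10 : |t * ⟪p, b k0⟫| ≤ |⟪u, b k0⟫ + t * ⟪p, b k0⟫| + |⟪u, b k0⟫| := by
            have := abs_sub (⟪u, b k0⟫ + t * ⟪p, b k0⟫) ⟪u, b k0⟫
            rwa [add_sub_cancel_left] at this
          linarith
        refine (norm_add_le _ _).trans ?_
        rw [norm_smul, hp, mul_one, Real.norm_eq_abs]
        linarith
      obtain ⟨c, hcK, hmin⟩ := (Metric.isCompact_of_isClosed_isBounded hKc hKb).exists_isMinOn
        ⟨a i, hai, le_refl C⟩ (continuous_cost (dataMatrix b a)).continuousOn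
      refine ⟨c, hcK.1, isMinOn_iff.2 fun c' hc' => ?_⟩
      by_cases h : cost (dataMatrix b a) c' ≤ C
      · exact isMinOn_iff.1 hmin c' ⟨hc', h⟩
      · exact (show cost (dataMatrix b a) c ≤ C from hcK.2).trans (not_le.1 h).le
  · have hlt : ∀ i j, innovationValue (dataMatrix b a) (c (Sum.inr i)) <
        innovationValue (dataMatrix b a) (c (Sum.inl j)) := by
      intro i j
      unfold innovationValue
      have h3 := hinl i _ (hc (Sum.inr i)).1
      have h4 : c (Sum.inl j) = (1 / ⟪b j, p⟫) • p := (hout j _).1 (hc (Sum.inl j))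
      rw [h4, hcost0]
      have hSp : 0 < S := (hxp j).trans_le
        (Finset.single_le_sum (f := fun i => |⟪p, b i⟫|) (fun _ _ => abs_nonneg _)
          (Finset.mem_univ j))
      have h5 : S / |⟪p, b j⟫| ≤ β * S := by
        have := mul_le_mul_of_nonneg_right (hβ j) hS0
        rwa [one_div_mul_eq_div] at this
      exact one_div_lt_one_div_of_lt (div_pos hSp (hxp j))
        (by nlinarith [mul_pos hβp hSp])
    exact ⟨hlt, recoversExactly_of_lt hno (span_range_eq_of_le_sum_abs_inner ha hLp hL) hbU hlt⟩

end Optimality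

/-! ### Transfer to the laws of the data -/

section Laws

/-- Only an upper bound is needed, so S may be an arbitrary set. -/
lemma measure_mem_le_pi {Ω E : Type*} [MeasurableSpace Ω] [MeasurableSpace E] {P : Measure Ω}
    [IsProbabilityMeasure P] {n : ℕ} {μ : Measure E} {X : Fin n → Ω → E}
    (hX : ∀ i, HasLaw (X i) μ P) (h : iIndepFun X P) (S : Set (Fin n → E)) :
    P {ω | (fun i => X i ω) ∈ S} ≤ Measure.pi (fun _ : Fin n => μ) S := by
  have h1 := (iIndepFun_iff_map_fun_eq_pi_map fun i => (hX i).aemeasurable).1 h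
  simp only [fun i => (hX i).map_eq] at h1
  rw [← h1]
  exact Measure.le_map_apply (aemeasurable_pi_lambda _ fun i => (hX i).aemeasurable) S

variable {M : ℕ}

lemma ae_mem_and_norm_eq_one_subspaceSphereUniform (U : Submodule ℝ (EuclideanSpace ℝ (Fin M)))
    [Nontrivial U] : ∀ᵐ x ∂subspaceSphereUniform U, x ∈ U ∧ ‖x‖ = 1 := by
  have hU : MeasurableSet (U : Set (EuclideanSpace ℝ (Fin M))) :=
    U.closed_of_finiteDimensional.measurableSet
  have hs : MeasurableSet {x : EuclideanSpace ℝ (Fin M) | x ∈ U ∧ ‖x‖ = 1} :=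
    hU.inter (isClosed_eq continuous_norm continuous_const).measurableSet
  rw [subspaceSphereUniform, ae_map_iff (by fun_prop) hs]
  filter_upwards [ae_norm_eq_one_sphereUniform U] with x hx
  exact ⟨x.2, by simpa using hx⟩

/-- The permeance of independent uniform directions of a subspace. -/
lemma measure_exists_mem_sum_abs_inner_lt_le {U : Submodule ℝ (EuclideanSpace ℝ (Fin M))}
    (hU : 2 ≤ Module.finrank ℝ U) (n : ℕ) {y : ℝ} (hy : 0 < y) :
    Measure.pi (fun _ : Fin n => subspaceSphereUniform U) {a | ∃ x ∈ U, ‖x‖ = 1 ∧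
      ∑ j, |⟪x, a j⟫| < √(2 / Real.pi) * (n / √(Module.finrank ℝ U)) - 2 * √n -
        √(2 * n * y / ((Module.finrank ℝ U : ℝ) - 1))} ≤ ENNReal.ofReal (Real.exp (-y)) := by
  have : Nontrivial U := Module.nontrivial_of_finrank_pos (R := ℝ) (by omega)
  set L := √(2 / Real.pi) * (n / √(Module.finrank ℝ U)) - 2 * √n -
        √(2 * n * y / ((Module.finrank ℝ U : ℝ) - 1)) with hL
  have hS : MeasurableSet {a : Fin n → EuclideanSpace ℝ (Fin M) | ∃ x ∈ U, ‖x‖ = 1 ∧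
      ∑ j, |⟪x, a j⟫| < L} := by
    have : {a : Fin n → EuclideanSpace ℝ (Fin M) | ∃ x ∈ U, ‖x‖ = 1 ∧ ∑ j, |⟪x, a j⟫| < L} =
        ⋃ x ∈ {x : EuclideanSpace ℝ (Fin M) | x ∈ U ∧ ‖x‖ = 1}, {a | ∑ j, |⟪x, a j⟫| < L} := by
      ext a
      simp [and_assoc]
    rw [this]
    exact (isOpen_biUnion fun x _ => isOpen_lt (by fun_prop) continuous_const).measurableSet
  have hpi : Measure.pi (fun _ : Fin n => subspaceSphereUniform U) =
      (Measure.pi (fun _ : Fin n => sphereUniform U)).map fun a i => (a i : EuclideanSpace ℝ _) := by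
    rw [Measure.pi_map_pi fun _ => by fun_prop]
    rfl
  rw [hpi, Measure.map_apply (by fun_prop) hS]
  refine (measure_mono ?_).trans (measure_exists_sum_abs_inner_lt_le hU n hy)
  rintro a ⟨x, hx, hx1, hlt⟩
  exact ⟨⟨x, hx⟩, by simpa using hx1, hlt⟩

end Laws

/-! ### Clustered outliers and the sufficient conditions -/

section Outliers

variable {M : ℕ} {U : Submodule ℝ (EuclideanSpace ℝ (Fin M))} {q : EuclideanSpace ℝ (Fin M)}

lemma norm_sub_starProjection_pos (hqU : q ∉ U) : 0 < ‖q - U.starProjection q‖ := by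
  rw [norm_pos_iff, sub_ne_zero]
  intro h
  exact hqU (h ▸ Submodule.starProjection_apply_mem U q)

lemma norm_qPerp (hqU : q ∉ U) : ‖qPerp U q‖ = 1 := by
  have h := norm_sub_starProjection_pos hqU
  rw [qPerp, norm_smul, Real.norm_of_nonneg (by positivity), one_div_mul_cancel h.ne']

lemma inner_qPerp_of_mem {u : EuclideanSpace ℝ (Fin M)} (hu : u ∈ U) : ⟪qPerp U q, u⟫ = 0 := by
  rw [qPerp, inner_smul_left, Submodule.starProjection_inner_eq_zero q u hu, mul_zero]

lemma mem_sup_span_singleton_iff (hqU : q ∉ U) (c : EuclideanSpace ℝ (Fin M)) :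
    c ∈ U ⊔ Submodule.span ℝ {q} ↔ ∃ u ∈ U, ∃ t : ℝ, c = u + t • qPerp U q := by
  have h := (norm_sub_starProjection_pos hqU).ne'
  have hqe : q = U.starProjection q + ‖q - U.starProjection q‖ • qPerp U q := by
    rw [qPerp, smul_smul, mul_one_div_cancel h, one_smul, add_sub_cancel]
  rw [Submodule.mem_sup]
  constructor
  · rintro ⟨u, hu, z, hz, rfl⟩
    obtain ⟨t, rfl⟩ := Submodule.mem_span_singleton.1 hz
    refine ⟨u + t • U.starProjection q,
      U.add_mem hu (U.smul_mem t (Submodule.starProjection_apply_mem U q)),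
      t * ‖q - U.starProjection q‖, ?_⟩
    nth_rewrite 1 [hqe]
    rw [smul_add, smul_smul, add_assoc]
  · rintro ⟨u, hu, t, rfl⟩
    refine ⟨u - (t / ‖q - U.starProjection q‖) • U.starProjection q,
      U.sub_mem hu (U.smul_mem _ (Submodule.starProjection_apply_mem U q)),
      (t / ‖q - U.starProjection q‖) • q,
      Submodule.smul_mem _ _ (Submodule.mem_span_singleton_self q), ?_⟩
    rw [qPerp, smul_smul, smul_sub, mul_one_div]
    abel

/-- The entry 1 of the maximum already matches the constant 3 in the tail bounds. -/
lemma nine_le_cDelta (M r no : ℕ) (δ : ℝ) : 9 ≤ cDelta M r no δ := by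
  rw [cDelta]
  nlinarith [le_max_left (1 : ℝ) (max √(8 * M * Real.pi / (((M : ℝ) - 1) * r))
    √(8 * M * Real.log (no / δ) / (((M : ℝ) - 1) * r)))]

lemma nine_le_cDelta'' (M no : ℕ) (δ : ℝ) : 9 ≤ cDelta'' M no δ := by
  rw [cDelta'']
  nlinarith [le_max_left (1 : ℝ) (max √(8 * M * Real.pi / ((M : ℝ) - 1))
    √(8 * M * Real.log (no / δ) / ((M : ℝ) - 1)))]

lemma three_mul_sqrt_le {c x y : ℝ} (hc : 9 ≤ c) (hx : 0 ≤ x) (hxy : c * x = y) :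
    3 * √x ≤ √y := by
  rw [show (3 : ℝ) = √9 by rw [show (9 : ℝ) = 3 ^ 2 by norm_num, Real.sqrt_sq (by norm_num)],
    ← Real.sqrt_mul (by norm_num), ← hxy]
  gcongr

lemma norm_clusteredOutlier_sq_le {η : ℝ} (hη : 0 ≤ η) (hq : ‖q‖ = 1)
    {v : EuclideanSpace ℝ (Fin M)} (hv : ‖v‖ = 1) : ‖clusteredOutlier q η v‖ ^ 2 ≤ 2 := by
  have h1 : ‖q + η • v‖ ≤ 1 + η := by
    refine (norm_add_le _ _).trans ?_
    rw [hq, norm_smul, hv, mul_one, Real.norm_of_nonneg hη]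
  rw [clusteredOutlier, norm_smul, mul_pow, Real.norm_of_nonneg (by positivity), one_div, inv_pow,
    Real.sq_sqrt (by positivity), inv_mul_le_iff₀ (by positivity)]
  nlinarith [norm_nonneg (q + η • v), sq_nonneg (1 - η)]

/-- Exact recovery once the inliers and the outliers satisfy the three concentration
inequalities. -/
theorem recovery_of_sufficientConditions {ni no : ℕ} (hno : 1 ≤ no) (hq : ‖q‖ = 1) (hqU : q ∉ U)
    {η δ s : ℝ} (hη : 0 < η) (hηq : η < |⟪q, qPerp U q⟫|) (hℓ : 0 ≤ Real.log (no / δ))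
    (hs : |s| = 1) (hsq : s * ⟪q, qPerp U q⟫ = |⟪q, qPerp U q⟫|)
    {a : Fin ni → EuclideanSpace ℝ (Fin M)} (ha : ∀ i, a i ∈ U ∧ ‖a i‖ = 1)
    {v : Fin no → EuclideanSpace ℝ (Fin M)} (hv : ∀ i, ‖v i‖ = 1)
    (h1 : ∀ x ∈ U, ‖x‖ = 1 → √(2 / Real.pi) * (ni / √(Module.finrank ℝ U)) - 2 * √ni -
      √(2 * ni * Real.log (1 / δ) / ((Module.finrank ℝ U : ℝ) - 1)) ≤ ∑ j, |⟪x, a j⟫|)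
    (h2 : ‖U.starProjection (∑ i, v i)‖ ≤
      3 * √(no * Module.finrank ℝ U * Real.log (no / δ) / M))
    (h3 : ⟪s • qPerp U q, ∑ i, v i⟫ ≤ no * (3 * √(Real.log (no / δ) / M)))
    (hsuff : SufficientConditions ni (Module.finrank ℝ U) U q η δ
      fun i => clusteredOutlier q η (v i)) :
    (∀ k, ∃ c, IsOptimalDirection (dataMatrix (fun i => clusteredOutlier q η (v i)) a)
      (U ⊔ Submodule.span ℝ {q}) (dataMatrix (fun i => clusteredOutlier q η (v i)) a k) c) ∧
    (∀ j c, IsOptimalDirection (dataMatrix (fun i => clusteredOutlier q η (v i)) a)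
      (U ⊔ Submodule.span ℝ {q}) (clusteredOutlier q η (v j)) c ↔
        c = (1 / ⟪clusteredOutlier q η (v j), qPerp U q⟫) • qPerp U q) ∧
    ∀ c : Fin no ⊕ Fin ni → EuclideanSpace ℝ (Fin M),
      (∀ k, IsOptimalDirection (dataMatrix (fun i => clusteredOutlier q η (v i)) a)
        (U ⊔ Submodule.span ℝ {q}) (dataMatrix (fun i => clusteredOutlier q η (v i)) a k) (c k)) →
      (∀ i j, innovationValue (dataMatrix (fun i => clusteredOutlier q η (v i)) a) (c (Sum.inr i)) <
        innovationValue (dataMatrix (fun i => clusteredOutlier q η (v i)) a) (c (Sum.inl j))) ∧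
      RecoversExactly (dataMatrix (fun i => clusteredOutlier q η (v i)) a)
        (fun k => innovationValue (dataMatrix (fun i => clusteredOutlier q η (v i)) a) (c k))
        (Module.finrank ℝ U) U := by
  obtain ⟨hA, hB⟩ := hsuff
  set p := qPerp U q with hpdef
  have hp : ‖p‖ = 1 := norm_qPerp hqU
  set b : Fin no → EuclideanSpace ℝ (Fin M) := fun i => clusteredOutlier q η (v i) with hbdef
  set β := beta U q b with hβdef
  set N := √(1 + η ^ 2) with hN
  have hNp : 0 < N := by positivity
  set r := Module.finrank ℝ U
  set ℓ := Real.log (no / δ)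
  set L := √(2 / Real.pi) * (ni / √r) - 2 * √ni - √(2 * ni * Real.log (1 / δ) / ((r : ℝ) - 1))
    with hL
  have hbp : ∀ i, ⟪p, b i⟫ = (⟪q, p⟫ + η * ⟪p, v i⟫) / N := by
    intro i
    rw [hbdef]
    simp only [clusteredOutlier, inner_smul_right, inner_add_right]
    rw [real_inner_comm p q]
    ring
  have hsbN : ∀ i, s * ⟪p, b i⟫ = (|⟪q, p⟫| + η * (s * ⟪p, v i⟫)) / N := by
    intro i
    rw [hbp, ← hsq]; ring
  have hsv : ∀ i, |s * ⟪p, v i⟫| ≤ 1 := by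
    intro i
    rw [abs_mul, hs, one_mul]
    simpa [hp, hv i] using abs_real_inner_le_norm p (v i)
  -- A perturbation of size η < |qᵀp| cannot carry an outlier across U.
  have hsb : ∀ i, 0 < s * ⟪p, b i⟫ := by
    intro i
    rw [hsbN]
    refine div_pos ?_ hNp
    nlinarith [neg_le_of_abs_le (hsv i)]
  have habs : ∀ i, |⟪p, b i⟫| = s * ⟪p, b i⟫ := by
    intro i
    rw [← abs_of_pos (hsb i), abs_mul, hs, one_mul]
  have hβ : ∀ i, 1 / |⟪p, b i⟫| ≤ β := by
    intro i
    rw [hβdef, beta, real_inner_comm]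
    exact le_ciSup (f := fun i => 1 / |⟪b i, qPerp U q⟫|) (Set.finite_range _).bddAbove i
  have hβp : 0 < β := by
    refine lt_of_lt_of_le ?_ (hβ ⟨0, hno⟩)
    rw [habs]
    exact one_div_pos.2 (hsb _)
  have hLh : ∀ u ∈ U, L * ‖u‖ ≤ ∑ j, |⟪u, a j⟫| := by
    intro u hu
    rcases eq_or_ne u 0 with rfl | hu0
    · simp
    have hn : 0 < ‖u‖ := norm_pos_iff.2 hu0
    have h4 := h1 (‖u‖⁻¹ • u) (U.smul_mem _ hu) (by
      rw [norm_smul, norm_inv, norm_norm, inv_mul_cancel₀ hn.ne'])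
    simp_rw [inner_smul_left, conj_trivial, abs_mul] at h4
    rw [← Finset.mul_sum, abs_of_pos (by positivity), ← div_eq_inv_mul, le_div_iff₀ hn] at h4
    exact h4
  have hcal : calA ni r η β δ = N / (2 * β) * L := rfl
  rw [hcal] at hA hB
  have hM : (0 : ℝ) ≤ M := Nat.cast_nonneg M
  have hR2 : ‖U.starProjection (∑ i, v i)‖ ≤ √(no * r * cDelta M r no δ * ℓ / M) :=
    h2.trans (three_mul_sqrt_le (nine_le_cDelta M r no δ) (by positivity) (by ring))
  have hR3 : ⟪s • p, ∑ i, v i⟫ ≤ no * √(cDelta'' M no δ * ℓ / M) := by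
    refine h3.trans ?_
    gcongr
    exact three_mul_sqrt_le (nine_le_cDelta'' M no δ) (by positivity) (by ring)
  have hsum : ∑ i, b i = (1 / N) • ((no : ℝ) • q + η • ∑ i, v i) := by
    simp only [hbdef, clusteredOutlier]
    rw [← Finset.smul_sum, Finset.sum_add_distrib, ← Finset.smul_sum]
    simp [Nat.cast_smul_eq_nsmul, hN]
  have hPb : ‖U.starProjection (∑ i, b i)‖ ≤ (no * ‖U.starProjection q‖ +
      η * √(no * r * cDelta M r no δ * ℓ / M)) / N := by
    rw [hsum, map_smul, norm_smul, map_add, map_smul, map_smul,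
      Real.norm_of_nonneg (by positivity), one_div_mul_eq_div]
    gcongr
    refine (norm_add_le _ _).trans ?_
    rw [norm_smul, norm_smul, Real.norm_of_nonneg (by positivity), Real.norm_of_nonneg hη.le]
    gcongr
  have hpb : ∑ i, |⟪p, b i⟫| ≤ (no * |⟪q, p⟫| +
      no * η * √(cDelta'' M no δ * ℓ / M)) / N := by
    have : ∑ i, |⟪p, b i⟫| = (no * |⟪q, p⟫| + η * ⟪s • p, ∑ i, v i⟫) / N := by
      simp_rw [habs, hsbN]
      rw [← Finset.sum_div, Finset.sum_add_distrib, ← Finset.mul_sum, ← Finset.mul_sum,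
        ← inner_sum, inner_smul_left, conj_trivial]
      simp
    rw [this, show (no : ℝ) * η * √(cDelta'' M no δ * ℓ / M) =
      η * (no * √(cDelta'' M no δ * ℓ / M)) by ring]
    gcongr
  -- The prefactor √(1+η²)/(2β) of 𝒜 absorbs the normalisation of the outliers and the 2β of the
  -- deterministic criterion.
  have key : ∀ {x y : ℝ}, x ≤ y / N → N / (2 * β) * L > y → 2 * β * x < L := by
    intro x y hx hy
    calc 2 * β * x ≤ 2 * β * (y / N) := by gcongr
      _ < 2 * β * (N / (2 * β) * L / N) := by gcongr
      _ = L := by field_simp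
  have h := recovery_of_permeance (Q := U ⊔ Submodule.span ℝ {q}) hno hp
    (fun u hu => inner_qPerp_of_mem hu) (mem_sup_span_singleton_iff hqU) (fun i => (ha i).1)
    (fun i => (ha i).2) hsb (fun i => norm_clusteredOutlier_sq_le hη.le hq (hv i)) hLh hβ
    (key hPb hA) (key hpb hB)
  exact h

end Outliers

end ISearch

/-! ### The union bound over the exceptional events -/

theorem theorem2
    {Ω : Type*} [MeasurableSpace Ω] (P : Measure Ω) [IsProbabilityMeasure P]
    (M r ni no : ℕ) (hr : 2 ≤ r) (hno : 1 ≤ no)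
    (U : Submodule ℝ (EuclideanSpace ℝ (Fin M))) (hU : Module.finrank ℝ U = r)
    (q : EuclideanSpace ℝ (Fin M)) (hq : ‖q‖ = 1) (hqU : q ∉ U)
    (η : ℝ) (hη : 0 < η) (hηq : η < |⟪q, ISearch.qPerp U q⟫|)
    (δ : ℝ) (hδ : 0 < δ) (hδ1 : δ < 1)
    -- the inliers: independent, uniform on `U ∩ 𝕊^{M-1}`
    (a : Fin ni → Ω → EuclideanSpace ℝ (Fin M))
    (ha : ∀ i, HasLaw (a i) (ISearch.subspaceSphereUniform U) P) (ha_indep : iIndepFun a P)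
    -- the perturbations of the outliers: independent, uniform on `𝕊^{M-1}`
    (v : Fin no → Ω → EuclideanSpace ℝ (Fin M))
    (hv : ∀ i, HasLaw (v i) (ISearch.sphereUniform (EuclideanSpace ℝ (Fin M))) P)
    (hv_indep : iIndepFun v P)
    -- the outliers
    (b : Ω → Fin no → EuclideanSpace ℝ (Fin M))
    (hb : ∀ ω i, b ω i = ISearch.clusteredOutlier q η (v i ω))
    -- the data matrix
    (D : Ω → Fin no ⊕ Fin ni → EuclideanSpace ℝ (Fin M))
    (hD : ∀ ω, D ω = ISearch.dataMatrix (b ω) (fun i => a i ω))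
    -- the search space, the column space of `[U q]`
    (Q : Submodule ℝ (EuclideanSpace ℝ (Fin M))) (hQ : Q = U ⊔ Submodule.span ℝ {q}) :
    -- an event of probability at least `1 - 5δ` on which the conditions imply the conclusions
    ∃ G : Set Ω, MeasurableSet G ∧ 1 - 5 * δ ≤ P.real G ∧
      ∀ ω ∈ G, ISearch.SufficientConditions ni r U q η δ (b ω) →
        -- every direction search problem has an optimal point
        (∀ k, ∃ c, ISearch.IsOptimalDirection (D ω) Q (D ω k) c) ∧
        -- for the outliers it is unique and equal to `q^⊥ / (dᵀ q^⊥)`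
        (∀ j c, ISearch.IsOptimalDirection (D ω) Q (b ω j) c ↔
          c = (1 / ⟪b ω j, ISearch.qPerp U q⟫) • ISearch.qPerp U q) ∧
        -- whatever optimal points are selected, the outliers have larger Innovation Values
        -- than the inliers and `U` is recovered exactly
        ∀ c : Fin no ⊕ Fin ni → EuclideanSpace ℝ (Fin M),
          (∀ k, ISearch.IsOptimalDirection (D ω) Q (D ω k) (c k)) →
          (∀ i j, ISearch.innovationValue (D ω) (c (Sum.inr i)) <
            ISearch.innovationValue (D ω) (c (Sum.inl j))) ∧
          ISearch.RecoversExactly (D ω) (fun k => ISearch.innovationValue (D ω) (c k)) r U := by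
  subst hU hQ
  set r := Module.finrank ℝ U with hr_def
  -- For δ ≥ 1/5 the empty event suffices. Otherwise no/δ ≥ 5 > e, so log(no/δ) ≥ 1, as the
  -- projection bound requires.
  rcases le_or_gt 1 (5 * δ) with h5 | h5
  · exact ⟨∅, MeasurableSet.empty, by simpa using h5, by simp⟩
  have hnoR : (1 : ℝ) ≤ no := by exact_mod_cast hno
  -- As q ∉ U, the subspace is proper; hence M ≥ 3.
  have hMr : r + 1 ≤ M := by
    have hlt := Submodule.finrank_lt (s := U) (fun h => hqU (h ▸ Submodule.mem_top))
    rw [finrank_euclideanSpace_fin] at hlt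
    exact hlt
  have hUn : Nontrivial U := Module.nontrivial_of_finrank_pos (R := ℝ) (by omega)
  have hfin : Module.finrank ℝ (EuclideanSpace ℝ (Fin M)) = M := finrank_euclideanSpace_fin
  have hEn : Nontrivial (EuclideanSpace ℝ (Fin M)) :=
    Module.nontrivial_of_finrank_pos (R := ℝ) (by omega)
  have hratio : 5 ≤ no / δ := by
    rw [le_div_iff₀ hδ]
    linarith
  have hℓ : 1 ≤ Real.log (no / δ) := by
    rw [Real.le_log_iff_exp_le (by linarith)]
    linarith [Real.exp_one_lt_d9]
  have hexpℓ : ENNReal.ofReal (Real.exp (-Real.log (no / δ))) ≤ ENNReal.ofReal δ := by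
    refine ENNReal.ofReal_le_ofReal ?_
    rw [Real.exp_neg, Real.exp_log (by linarith), inv_div]
    exact div_le_self hδ.le hnoR
  have hexpy : ENNReal.ofReal (Real.exp (-Real.log (1 / δ))) = ENNReal.ofReal δ := by
    rw [Real.exp_neg, Real.exp_log (by positivity), one_div, inv_inv]
  have hy : 0 < Real.log (1 / δ) := Real.log_pos (by rw [one_div]; exact (one_lt_inv₀ hδ).2 hδ1)
  set p := ISearch.qPerp U q with hp_def
  have hp : ‖p‖ = 1 := ISearch.norm_qPerp hqU
  obtain ⟨s, hs, hsq⟩ : ∃ s : ℝ, |s| = 1 ∧ s * ⟪q, p⟫ = |⟪q, p⟫| := by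
    rcases le_total 0 ⟪q, p⟫ with h | h
    · exact ⟨1, abs_one, by rw [abs_of_nonneg h, one_mul]⟩
    · exact ⟨-1, by norm_num, by rw [abs_of_nonpos h, neg_one_mul]⟩
  have hsp : ‖s • p‖ = 1 := by rw [norm_smul, hp, mul_one, Real.norm_eq_abs, hs]
  have hB1 := (ISearch.measure_mem_le_pi ha ha_indep _).trans
    ((ISearch.measure_exists_mem_sum_abs_inner_lt_le hr ni hy).trans hexpy.le)
  have hB2 := (ISearch.measure_mem_le_pi hv hv_indep _).trans
    ((ISearch.measure_norm_starProjection_sum_gt_le (by omega) U (by omega) hno hℓ).trans hexpℓ)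
  have hB3 := (ISearch.measure_mem_le_pi hv hv_indep _).trans
    ((ISearch.measure_sum_inner_gt_le (by omega) hsp hno (by linarith)).trans hexpℓ)
  have hB4 : ∀ᵐ ω ∂P, (∀ i, a i ω ∈ U ∧ ‖a i ω‖ = 1) ∧ ∀ i, ‖v i ω‖ = 1 := by
    refine (ae_all_iff.2 fun i => ?_).and (ae_all_iff.2 fun i => ?_)
    · exact ae_of_ae_map (ha i).aemeasurable
        ((ha i).map_eq ▸ ISearch.ae_mem_and_norm_eq_one_subspaceSphereUniform U)
    · exact ae_of_ae_map (hv i).aemeasurable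
        ((hv i).map_eq ▸ ISearch.ae_norm_eq_one_sphereUniform _)
  rw [hfin] at hB2 hB3
  rw [ae_iff] at hB4
  set B1 := {ω | (fun i => a i ω) ∈ {a : Fin ni → EuclideanSpace ℝ (Fin M) | ∃ x ∈ U, ‖x‖ = 1 ∧
    ∑ j, |⟪x, a j⟫| < √(2 / Real.pi) * (ni / √r) - 2 * √ni -
      √(2 * ni * Real.log (1 / δ) / ((r : ℝ) - 1))}}
  set B2 := {ω | (fun i => v i ω) ∈ {v : Fin no → EuclideanSpace ℝ (Fin M) |
    3 * √(no * r * Real.log (no / δ) / M) < ‖U.starProjection (∑ j, v j)‖}}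
  set B3 := {ω | (fun i => v i ω) ∈ {v : Fin no → EuclideanSpace ℝ (Fin M) |
    no * (3 * √(Real.log (no / δ) / M)) < ⟪s • p, ∑ j, v j⟫}}
  set B4 := {ω | ¬((∀ i, a i ω ∈ U ∧ ‖a i ω‖ = 1) ∧ ∀ i, ‖v i ω‖ = 1)}
  have hB : P (B1 ∪ B2 ∪ B3 ∪ B4) ≤ ENNReal.ofReal (5 * δ) := by
    calc P (B1 ∪ B2 ∪ B3 ∪ B4) ≤ P B1 + P B2 + P B3 + P B4 := by
          refine (measure_union_le _ _).trans (add_le_add ?_ le_rfl)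
          refine (measure_union_le _ _).trans (add_le_add ?_ le_rfl)
          exact measure_union_le _ _
      _ ≤ ENNReal.ofReal δ + ENNReal.ofReal δ + ENNReal.ofReal δ + 0 := by
          gcongr
          exact hB4.le
      _ ≤ ENNReal.ofReal (5 * δ) := by
          rw [add_zero, ← ENNReal.ofReal_add hδ.le hδ.le, ← ENNReal.ofReal_add (by linarith) hδ.le]
          exact ENNReal.ofReal_le_ofReal (by linarith)
  -- The exceptional set need not be measurable; its measurable hull has the same measure.
  refine ⟨(toMeasurable P (B1 ∪ B2 ∪ B3 ∪ B4))ᶜ, (measurableSet_toMeasurable _ _).compl, ?_, ?_⟩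
  · rw [probReal_compl_eq_one_sub (measurableSet_toMeasurable _ _), measureReal_def,
      measure_toMeasurable]
    exact sub_le_sub_left (ENNReal.toReal_le_of_le_ofReal (by linarith) hB) _
  · intro ω hω hsuff
    have hω' : ω ∉ B1 ∪ B2 ∪ B3 ∪ B4 := fun h => hω (subset_toMeasurable _ _ h)
    simp only [Set.mem_union, not_or] at hω'
    obtain ⟨⟨⟨h1, h2⟩, h3⟩, h4⟩ := hω'
    have h4' := not_not.1 h4
    have hbω : b ω = fun i => ISearch.clusteredOutlier q η (v i ω) := funext fun i => hb ω i
    rw [hbω] at hsuff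
    rw [hD, hbω]
    exact ISearch.recovery_of_sufficientConditions hno hq hqU hη hηq (by linarith) hs hsq h4'.1 h4'.2
      (fun x hx hx1 => not_lt.1 fun hlt => h1 ⟨x, hx, hx1, hlt⟩) (not_lt.1 h2) (not_lt.1 h3) hsuff
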